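/- Let $T>0$, $\tfrac13<H<\tfrac12$, $r=\tfrac1{2H}$ and $p\in\big(\tfrac1H,\tfrac1{1-2H}\big)$. Let $R(s,t)=\tfrac12\big(s^{2H}+t^{2H}-|t-s|^{2H}\big)$ on $[0,T]^2$, let $\mathcal W=\{\omega\in C([0,T],\mathbb R):\omega(0)=0\}$, and let $\mathbb P$ be the law on $\mathcal W$ of fractional Brownian motion with Hurst parameter $H$, i.e. the Gaussian measure whose coordinate process is centred with covariance $R$. Let $\mathcal H\subset\mathcal W$ be its Cameron–Martin space, the image of the closure of $\mathcal W^*$ in $L^2(\mathbb P)$ under $Jf=\int_{\mathcal W}\omega f(\omega)\,d\mathbb P(\omega)$, with $\langle Jf,Jg\rangle_{\mathcal H}=\langle f,g\rangle_{L^2(\mathbb P)}$, so that $R(t,\cdot)\in\mathcal H$ is the reproducing kernel; let $\mathcal H^2=\mathcal H\otimes\mathbb R^2$, with $\|h\|^2=\|h^1\|_{\mathcal H}^2+\|h^2\|_{\mathcal H}^2$. For $f:[0,T]\to E$ ($E$ a normed space) let $\|f\|_p=\sup_\Pi\big(\sum_i\|f(t_i)-f(t_{i-1})\|^p\big)^{1/p}$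 over finite partitions $\Pi$ of $[0,T]$, and for $F:[0,T]^2\to\mathbb R$ let $\|F\|_r^{(2D)}=\sup_{\Pi_1,\Pi_2}\big(\sum_{i,j}|\Delta_{ij}F|^r\big)^{1/r}$, where $\Delta_{ij}F$ is the increment of $F$ over the rectangle $[s_{i-1},s_i]\times[t_{j-1},t_j]$. Let $\mathcal W_p^2$ be the closure, for $\|\cdot\|_p$, of $\{\omega\in C^\infty([0,T],\mathbb R^2):\omega(0)=0\}$ in the continuous paths starting at $0$, where $\mathbb R^2$ has the Euclidean norm. All integrals below are Young integrals, i.e. limits of Riemann–Stieltjes sums as the mesh tends to $0$, independent of the choice of partitions and intermediate points; those against $R(dt,\cdot)$ are limits in $\mathcal H^2$. For $\omega=(\omega^1,\omega^2)$ write $\tilde\omega=(\omega^2,-\omega^1)$, and for $h,k\in\mathcal H^2$ $$q(h,k)=\frac12\Big(\int_0^T h(t)\cdot d\tilde k(t)+\int_0^T k(t)\cdot d\tilde h(t)\Big).$$ These integrals exist, and there is a bounded linear operator $Q:\mathcal H^2\to\mathcal H^2$ with $\langle Qh,k\rangle_{\mathcal H^2}=q(h,k)$ for all $h,k\in\mathcal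 H^2$. Moreover $\mathcal H^2\subset\mathcal W_p^2$, and $Q$ extends to a bounded linear operator $Q:\mathcal W_p^2\to\mathcal H^2$ such that, for every $\omega\in\mathcal W_p^2$, the integral $\int_0^T\tilde\omega(t)\,R(dt,\cdot)$ exists, $$Q\omega=\tfrac12R(T,\cdot)\,\tilde\omega(T)-\int_0^T\tilde\omega(t)\,R(dt,\cdot),$$ and $$\|Q\omega\|_{\mathcal H^2}^2\le\Big(\frac{T^{2H}}4+2\|R\|_r^{(2D)}\Big)\|\omega\|_p^2,\qquad\text{where }\|R\|_r^{(2D)}<\infty .$$ -/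

import Mathlib

open MeasureTheory ProbabilityTheory Filter Topology
open scoped ENNReal

noncomputable section

namespace FBMArea

/-! ### Partitions, `p`-variation, Young integrals -/

/-- A finite partition `0 = t₀ < t₁ < ⋯ < tₙ = T` of `[0,T]`. -/
structure TimePartition (T : ℝ) where
  n : ℕ
  pt : Fin (n + 1) → Set.Icc (0 : ℝ) T
  strictMono : StrictMono pt
  pt_zero : (pt 0 : ℝ) = 0
  pt_last : (pt (Fin.last n) : ℝ) = T

/-- The mesh `|Π| = max (tᵢ - tᵢ₋₁)`. -/
def TimePartition.mesh {T : ℝ} (π : TimePartition T) : ℝ :=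
  ⨆ i : Fin π.n, ((π.pt i.succ : ℝ) - π.pt i.castSucc)

/-- A partition together with points `cᵢ ∈ (tᵢ₋₁, tᵢ)`. -/
structure TaggedPartition (T : ℝ) extends TimePartition T where
  tag : Fin n → Set.Icc (0 : ℝ) T
  tag_mem : ∀ i, tag i ∈ Set.Ioo (pt i.castSucc) (pt i.succ)

/-- The filter "`|Π| → 0`" on tagged partitions. -/
def meshFilter (T : ℝ) : Filter (TaggedPartition T) :=
  Filter.comap (fun τ => τ.toTimePartition.mesh) (𝓝 0)

section Variation

variable {T : ℝ} {E : Type*} [NormedAddCommGroup E]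

/-- `V_p(f : Π) = (∑ᵢ ‖f(tᵢ) - f(tᵢ₋₁)‖ᵖ)^(1/p)`. -/
def pVarSum (p : ℝ) (f : Set.Icc (0 : ℝ) T → E) (π : TimePartition T) : ℝ≥0∞ :=
  (∑ i : Fin π.n, ‖f (π.pt i.succ) - f (π.pt i.castSucc)‖ₑ ^ p) ^ (1 / p)

/-- The `p`-variation `‖f‖_p = sup_Π V_p(f : Π)`, with value `∞` allowed. -/
def pVar (p : ℝ) (f : Set.Icc (0 : ℝ) T → E) : ℝ≥0∞ :=
  ⨆ π : TimePartition T, pVarSum p f π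

/-- The two-dimensional `p`-variation over grids,
`‖F‖_p^{(2D)} = sup_{Π₁,Π₂} (∑ᵢⱼ ‖Δᵢⱼ F‖ᵖ)^(1/p)`, with value `∞` allowed. -/
def pVar2 (p : ℝ) (F : Set.Icc (0 : ℝ) T → Set.Icc (0 : ℝ) T → E) : ℝ≥0∞ :=
  ⨆ (π : TimePartition T) (σ : TimePartition T),
    (∑ i : Fin π.n, ∑ j : Fin σ.n,
      ‖F (π.pt i.succ) (σ.pt j.succ) - F (π.pt i.succ) (σ.pt j.castSucc)
        - F (π.pt i.castSucc) (σ.pt j.succ) + F (π.pt i.castSucc) (σ.pt j.castSucc)‖ₑ ^ p)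
      ^ (1 / p)

theorem pVar_add_le {p : ℝ} (hp : 1 ≤ p) (f g : Set.Icc (0 : ℝ) T → E) :
    pVar p (f + g) ≤ pVar p f + pVar p g := by
  refine iSup_le fun π => ?_
  refine le_trans ?_ (add_le_add (le_iSup (pVarSum p f) π) (le_iSup (pVarSum p g) π))
  refine le_trans ?_ (ENNReal.Lp_add_le _ _ _ hp)
  unfold pVarSum
  gcongr with i
  rw [Pi.add_apply, Pi.add_apply, add_sub_add_comm]
  exact enorm_add_le _ _

end Variation

section Young

variable {T : ℝ} {A B C : Type*} [AddCommGroup B] [AddCommGroup C]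

/-- The Riemann–Stieltjes sum `∑ᵢ m(f(cᵢ), g(tᵢ) - g(tᵢ₋₁))`, for a product `m`. -/
def youngSum (m : A → B → C) (f : Set.Icc (0 : ℝ) T → A) (g : Set.Icc (0 : ℝ) T → B)
    (τ : TaggedPartition T) : C :=
  ∑ i : Fin τ.n, m (f (τ.tag i)) (g (τ.pt i.succ) - g (τ.pt i.castSucc))

variable [TopologicalSpace C]

/-- `I` is the Young integral `∫₀ᵀ m(f, dg)`: the sums converge to `I` as the mesh tends to `0`,
whatever the partitions and the intermediate points. -/
def HasYoungIntegral (m : A → B → C) (f : Set.Icc (0 : ℝ) T → A) (g : Set.Icc (0 : ℝ) T → B)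
    (I : C) : Prop :=
  Tendsto (youngSum m f g) (meshFilter T) (𝓝 I)

/-- The Young integral `∫₀ᵀ m(f, dg)` exists. -/
def YoungIntegrable (m : A → B → C) (f : Set.Icc (0 : ℝ) T → A)
    (g : Set.Icc (0 : ℝ) T → B) : Prop :=
  ∃ I, HasYoungIntegral m f g I

/-- The value of the Young integral `∫₀ᵀ m(f, dg)` (meaningful if it exists). -/
def youngIntegral (m : A → B → C) (f : Set.Icc (0 : ℝ) T → A)
    (g : Set.Icc (0 : ℝ) T → B) : C :=
  have : Nonempty C := ⟨0⟩
  limUnder (meshFilter T) (youngSum m f g)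

end Young

/-! ### The path spaces `𝒲` and `𝒲_p` -/

/-- Continuous paths on `[0,T]` that start at `0`. -/
def startZero (T : ℝ) (E : Type*) [NormedAddCommGroup E] [NormedSpace ℝ E] :
    Submodule ℝ C(Set.Icc (0 : ℝ) T, E) where
  carrier := {ω | ∀ t : Set.Icc (0 : ℝ) T, (t : ℝ) = 0 → ω t = 0}
  zero_mem' := by intro t _; rfl
  add_mem' := by
    intro a b ha hb t ht
    simp [ha t ht, hb t ht]
  smul_mem' := by
    intro c a ha t ht
    simp [ha t ht]

/-- The Banach space `𝒲 = {ω ∈ C([0,T],ℝ) : ω(0) = 0}`, with the sup norm. -/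
def WienerSpace (T : ℝ) : Type := startZero T ℝ

namespace WienerSpace

variable {T : ℝ}

instance : NormedAddCommGroup (WienerSpace T) :=
  inferInstanceAs (NormedAddCommGroup (startZero T ℝ))

instance : NormedSpace ℝ (WienerSpace T) := inferInstanceAs (NormedSpace ℝ (startZero T ℝ))

instance : SecondCountableTopology (WienerSpace T) :=
  inferInstanceAs (SecondCountableTopology (startZero T ℝ))

instance : CompleteSpace (WienerSpace T) := by
  have hc : IsClosed (startZero T ℝ : Set C(Set.Icc (0 : ℝ) T, ℝ)) := by
    have : (startZero T ℝ : Set C(Set.Icc (0 : ℝ) T, ℝ)) =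
        ⋂ (t : Set.Icc (0 : ℝ) T) (_ : (t : ℝ) = 0), {ω | ω t = 0} := by
      ext ω
      simp [startZero]
    rw [this]
    exact isClosed_iInter fun t => isClosed_iInter fun _ =>
      isClosed_eq (continuous_eval_const t) continuous_const
  exact hc.completeSpace_coe

/-- `𝒲` carries its Borel `σ`-algebra. -/
instance : MeasurableSpace (WienerSpace T) := borel _

instance : BorelSpace (WienerSpace T) := ⟨rfl⟩

/-- The underlying continuous path. -/
def path (ω : WienerSpace T) : C(Set.Icc (0 : ℝ) T, ℝ) := Subtype.val ω

/-- Evaluation at time `t`, an element of `𝒲*`. -/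
def evalDual (t : Set.Icc (0 : ℝ) T) : StrongDual ℝ (WienerSpace T) :=
  LinearMap.mkContinuous
    { toFun := fun ω => ω.path t
      map_add' := fun _ _ => rfl
      map_smul' := fun _ _ => rfl } 1
    (fun ω => by
      rw [one_mul]
      exact ω.path.norm_coe_le_norm t)

end WienerSpace

open WienerSpace

section WienerP

variable (T p : ℝ) (E : Type*) [NormedAddCommGroup E] [NormedSpace ℝ E]

/-- `C^∞([0,T],E) ∩ {ω(0) = 0}`. -/
def smoothPaths : Set C(Set.Icc (0 : ℝ) T, E) :=
  {g | g ∈ startZero T E ∧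
    ∃ f : ℝ → E, ContDiffOn ℝ (⊤ : ℕ∞) f (Set.Icc 0 T) ∧ ∀ t : Set.Icc (0 : ℝ) T, g t = f t}

variable {T p E}

theorem pVar_smul (hp : 1 ≤ p) (c : ℝ) (f : Set.Icc (0 : ℝ) T → E) :
    pVar p (c • f) = ‖c‖ₑ * pVar p f := by
  have h0 : 0 < p := by linarith
  unfold pVar
  rw [ENNReal.mul_iSup]
  refine iSup_congr fun π => ?_
  unfold pVarSum
  simp only [Pi.smul_apply, ← smul_sub, enorm_smul, ENNReal.mul_rpow_of_nonneg _ _ h0.le]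
  rw [← Finset.mul_sum, ENNReal.mul_rpow_of_nonneg _ _ (by positivity), ← ENNReal.rpow_mul,
    mul_one_div_cancel h0.ne', ENNReal.rpow_one]

theorem pVar_zero (hp : 1 ≤ p) : pVar p (0 : Set.Icc (0 : ℝ) T → E) = 0 := by
  have := pVar_smul hp (0 : ℝ) (0 : Set.Icc (0 : ℝ) T → E)
  simpa using this

theorem TimePartition.sum_sub (π : TimePartition T) :
    ∑ i : Fin π.n, ((π.pt i.succ : ℝ) - π.pt i.castSucc) = T := by
  have key : ∀ (n : ℕ) (x : Fin (n + 1) → ℝ),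
      ∑ i : Fin n, (x i.succ - x i.castSucc) = x (Fin.last n) - x 0 := by
    intro n
    induction n with
    | zero => intro x; simp
    | succ n ih =>
      intro x
      rw [Fin.sum_univ_castSucc]
      have := ih (fun j => x j.castSucc)
      simp only [Fin.succ_castSucc, Fin.castSucc_zero, Fin.succ_last] at this ⊢
      rw [this]
      ring
  have := key π.n (fun i => (π.pt i : ℝ))
  simpa [π.pt_zero, π.pt_last] using this

theorem pVar_smooth_ne_top (hp : 1 ≤ p) {g : C(Set.Icc (0 : ℝ) T, E)}
    (hg : g ∈ smoothPaths T E) : pVar p g ≠ ⊤ := by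
  obtain ⟨-, f, hf, hgf⟩ := hg
  have h0 : 0 < p := by linarith
  obtain ⟨K, hK⟩ := (hf.of_le (m := 1) (by norm_cast)).exists_lipschitzOnWith
    (by simp) (convex_Icc 0 T) isCompact_Icc
  set S : ℝ≥0∞ := K * ENNReal.ofReal T
  have hS : S ≠ ⊤ := ENNReal.mul_ne_top ENNReal.coe_ne_top ENNReal.ofReal_ne_top
  have hbound : pVar p g ≤ (S ^ (p - 1) * S) ^ (1 / p) := by
    refine iSup_le fun π => ?_
    unfold pVarSum
    gcongr
    have hi : ∀ i : Fin π.n, ‖g (π.pt i.succ) - g (π.pt i.castSucc)‖ₑ ≤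
        K * ENNReal.ofReal ((π.pt i.succ : ℝ) - π.pt i.castSucc) := by
      intro i
      rw [hgf, hgf, ← edist_eq_enorm_sub]
      refine (hK (π.pt i.succ).2 (π.pt i.castSucc).2).trans ?_
      rw [edist_dist, Real.dist_eq, abs_of_nonneg]
      exact sub_nonneg.2 (π.strictMono (Fin.castSucc_lt_succ)).le
    have hnn : ∀ i : Fin π.n, 0 ≤ (π.pt i.succ : ℝ) - π.pt i.castSucc := fun i =>
      sub_nonneg.2 (π.strictMono (Fin.castSucc_lt_succ)).le
    have hsum : ∑ i : Fin π.n, ‖g (π.pt i.succ) - g (π.pt i.castSucc)‖ₑ ≤ S := by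
      refine (Finset.sum_le_sum fun i _ => hi i).trans ?_
      rw [← Finset.mul_sum, ← ENNReal.ofReal_sum_of_nonneg (fun i _ => hnn i), π.sum_sub]
    calc ∑ i : Fin π.n, ‖g (π.pt i.succ) - g (π.pt i.castSucc)‖ₑ ^ p
        ≤ ∑ i : Fin π.n, S ^ (p - 1) * ‖g (π.pt i.succ) - g (π.pt i.castSucc)‖ₑ := by
          refine Finset.sum_le_sum fun i _ => ?_
          have hle : ‖g (π.pt i.succ) - g (π.pt i.castSucc)‖ₑ ≤ S :=
            (Finset.single_le_sum (f := fun i : Fin π.n =>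
              ‖g (π.pt i.succ) - g (π.pt i.castSucc)‖ₑ) (fun _ _ => zero_le)
              (Finset.mem_univ i)).trans hsum
          calc ‖g (π.pt i.succ) - g (π.pt i.castSucc)‖ₑ ^ p
              = ‖g (π.pt i.succ) - g (π.pt i.castSucc)‖ₑ ^ (p - 1)
                * ‖g (π.pt i.succ) - g (π.pt i.castSucc)‖ₑ ^ (1 : ℝ) := by
                rw [← ENNReal.rpow_add_of_nonneg _ _ (by linarith) zero_le_one]
                congr 1
                ring
            _ ≤ _ := by
                rw [ENNReal.rpow_one]
                gcongr
      _ ≤ S ^ (p - 1) * S := by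
          rw [← Finset.mul_sum]
          gcongr
  refine ne_top_of_le_ne_top ?_ hbound
  exact ENNReal.rpow_ne_top_of_nonneg (by positivity)
    (ENNReal.mul_ne_top (ENNReal.rpow_ne_top_of_nonneg (by linarith) hS) hS)

/-- The `p`-variation separates paths that start at `0`. -/
theorem eq_zero_of_pVar_eq_zero (hp : 1 ≤ p) {g : C(Set.Icc (0 : ℝ) T, E)}
    (hg : g ∈ startZero T E) (h : pVar p g = 0) : g = 0 := by
  have h0 : 0 < p := by linarith
  have hinc : ∀ (π : TimePartition T) (i : Fin π.n),
      g (π.pt i.succ) = g (π.pt i.castSucc) := by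
    intro π i
    have h1 : pVarSum p g π = 0 := le_antisymm (h ▸ le_iSup (pVarSum p g) π) zero_le
    unfold pVarSum at h1
    rw [ENNReal.rpow_eq_zero_iff_of_pos (by positivity), Finset.sum_eq_zero_iff] at h1
    have h2 := h1 i (Finset.mem_univ i)
    rw [ENNReal.rpow_eq_zero_iff_of_pos h0, enorm_eq_zero, sub_eq_zero] at h2
    exact h2
  ext t
  obtain ⟨t, ht⟩ := t
  have hT : 0 ≤ T := ht.1.trans ht.2
  rcases ht.1.eq_or_lt with h0t | h0t
  · exact hg ⟨t, ht⟩ h0t.symm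
  have hz : g ⟨0, le_rfl, hT⟩ = 0 := hg _ rfl
  rcases ht.2.eq_or_lt with htT | htT
  · let π : TimePartition T :=
      { n := 1
        pt := ![⟨0, le_rfl, hT⟩, ⟨t, ht⟩]
        strictMono := by
          rw [Fin.strictMono_iff_lt_succ]
          intro i
          fin_cases i
          exact h0t
        pt_zero := rfl
        pt_last := htT }
    have := hinc π 0
    exact this.trans hz
  · let π : TimePartition T :=
      { n := 2
        pt := ![⟨0, le_rfl, hT⟩, ⟨t, ht⟩, ⟨T, hT, le_rfl⟩]
        strictMono := by
          rw [Fin.strictMono_iff_lt_succ]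
          intro i
          fin_cases i
          · exact h0t
          · exact htT
        pt_zero := rfl
        pt_last := rfl }
    have := hinc π 0
    exact this.trans hz

variable (T p E)

/-- The paths of `𝒲_p`: the closure of `C^∞([0,T],E) ∩ {ω(0) = 0}` for the `p`-variation norm,
inside the continuous paths that start at `0`. -/
def wienerPSubmodule [hp : Fact (1 ≤ p)] : Submodule ℝ C(Set.Icc (0 : ℝ) T, E) where
  carrier := {ω | ω ∈ startZero T E ∧
    ∀ ε : ℝ≥0∞, 0 < ε → ∃ g ∈ smoothPaths T E, pVar p (ω - g : C(Set.Icc (0 : ℝ) T, E)) < ε}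
  zero_mem' := by
    refine ⟨zero_mem _, fun ε hε => ⟨0, ⟨zero_mem _, 0, contDiffOn_const, fun _ => rfl⟩, ?_⟩⟩
    rw [sub_zero, ContinuousMap.coe_zero, pVar_zero hp.out]
    exact hε
  add_mem' := by
    rintro a b ⟨ha0, ha⟩ ⟨hb0, hb⟩
    refine ⟨add_mem ha0 hb0, fun ε hε => ?_⟩
    obtain ⟨g, ⟨hg0, f, hf, hgf⟩, hag⟩ := ha (ε / 2) (ENNReal.half_pos hε.ne')
    obtain ⟨g', ⟨hg0', f', hf', hgf'⟩, hbg⟩ := hb (ε / 2) (ENNReal.half_pos hε.ne')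
    refine ⟨g + g', ⟨add_mem hg0 hg0', f + f', hf.add hf', fun t => ?_⟩, ?_⟩
    · simp [hgf t, hgf' t]
    · rw [add_sub_add_comm, ContinuousMap.coe_add]
      refine (pVar_add_le hp.out _ _).trans_lt ?_
      rw [← ENNReal.add_halves ε]
      exact ENNReal.add_lt_add hag hbg
  smul_mem' := by
    rintro c a ⟨ha0, ha⟩
    refine ⟨Submodule.smul_mem _ c ha0, fun ε hε => ?_⟩
    have hc : ‖c‖ₑ ≠ ⊤ := enorm_ne_top
    obtain ⟨g, ⟨hg0, f, hf, hgf⟩, hag⟩ := ha (ε / (‖c‖ₑ + 1))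
      (ENNReal.div_pos hε.ne' (ENNReal.add_ne_top.2 ⟨hc, ENNReal.one_ne_top⟩))
    refine ⟨c • g, ⟨Submodule.smul_mem _ c hg0, fun t => c • f t, hf.const_smul c, fun t => ?_⟩, ?_⟩
    · simp [hgf t]
    · rw [← smul_sub, ContinuousMap.coe_smul, pVar_smul hp.out]
      have h1 : (‖c‖ₑ + 1) * pVar p (a - g : C(Set.Icc (0 : ℝ) T, E)) < ε := by
        rw [mul_comm]
        exact ENNReal.mul_lt_of_lt_div hag
      refine lt_of_le_of_lt ?_ h1
      gcongr
      exact le_self_add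

/-- The space `𝒲_p` of `E`-valued paths; it is normed by the `p`-variation below. -/
def WienerP [Fact (1 ≤ p)] : Type _ := wienerPSubmodule T p E

namespace WienerP

variable {T p E} [hp : Fact (1 ≤ p)]

instance : AddCommGroup (WienerP T p E) := inferInstanceAs (AddCommGroup (wienerPSubmodule T p E))

instance : Module ℝ (WienerP T p E) := inferInstanceAs (Module ℝ (wienerPSubmodule T p E))

/-- The underlying continuous path. -/
def path (ω : WienerP T p E) : C(Set.Icc (0 : ℝ) T, E) := Subtype.val ω

theorem pVar_ne_top (ω : WienerP T p E) : pVar p ω.path ≠ ⊤ := by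
  obtain ⟨g, hg, hlt⟩ := (Subtype.prop ω : ω.path ∈ wienerPSubmodule T p E).2 1 one_pos
  have h : (ω.path : Set.Icc (0 : ℝ) T → E)
      = ((ω.path - g : C(Set.Icc (0 : ℝ) T, E)) : Set.Icc (0 : ℝ) T → E)
        + (g : Set.Icc (0 : ℝ) T → E) := by
    ext t; simp
  rw [h]
  exact ne_top_of_le_ne_top
    (ENNReal.add_ne_top.2 ⟨(hlt.trans ENNReal.one_lt_top).ne, pVar_smooth_ne_top hp.out hg⟩)
    (pVar_add_le hp.out _ _)

/-- The `p`-variation norm `‖ω‖_p`. -/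
instance : Norm (WienerP T p E) := ⟨fun ω => (pVar p ω.path).toReal⟩

theorem norm_def (ω : WienerP T p E) : ‖ω‖ = (pVar p ω.path).toReal := rfl

theorem normCore : NormedSpace.Core ℝ (WienerP T p E) where
  norm_nonneg _ := ENNReal.toReal_nonneg
  norm_smul c ω := by
    have h : ((c • ω).path : Set.Icc (0 : ℝ) T → E) = c • (ω.path : Set.Icc (0 : ℝ) T → E) := rfl
    rw [norm_def, norm_def, h, pVar_smul hp.out, ENNReal.toReal_mul, toReal_enorm]
  norm_triangle a b := by
    have h : ((a + b).path : Set.Icc (0 : ℝ) T → E)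
        = (a.path : Set.Icc (0 : ℝ) T → E) + (b.path : Set.Icc (0 : ℝ) T → E) := rfl
    rw [norm_def, norm_def, norm_def, h, ← ENNReal.toReal_add a.pVar_ne_top b.pVar_ne_top]
    exact ENNReal.toReal_mono (ENNReal.add_ne_top.2 ⟨a.pVar_ne_top, b.pVar_ne_top⟩)
      (pVar_add_le hp.out _ _)
  norm_eq_zero_iff ω := by
    constructor
    · intro h
      rw [norm_def] at h
      have h1 : pVar p ω.path = 0 :=
        ((ENNReal.toReal_eq_zero_iff _).1 h).resolve_right ω.pVar_ne_top
      exact Subtype.ext (eq_zero_of_pVar_eq_zero hp.out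
        (Subtype.prop ω : ω.path ∈ wienerPSubmodule T p E).1 h1)
    · rintro rfl
      have h : ((0 : WienerP T p E).path : Set.Icc (0 : ℝ) T → E) = 0 := rfl
      rw [norm_def, h, pVar_zero hp.out, ENNReal.toReal_zero]

instance : NormedAddCommGroup (WienerP T p E) := NormedAddCommGroup.ofCore normCore

instance : NormedSpace ℝ (WienerP T p E) := NormedSpace.ofCore normCore

end WienerP

end WienerP

/-! ### The Cameron–Martin space -/

section CameronMartin

variable {T : ℝ} (P : Measure (WienerSpace T))

/-- The closure of the dual `𝒲*` in `L²(P)`. -/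
def dualClosure : Submodule ℝ (Lp ℝ 2 P) :=
  (LinearMap.range (StrongDual.toLp (𝕜 := ℝ) P 2).toLinearMap).topologicalClosure

variable [IsGaussian P]

theorem integrable_smul_id (f : Lp ℝ 2 P) :
    Integrable (fun ω : WienerSpace T => f ω • ω) P :=
  memLp_one_iff_integrable.1 (MemLp.smul (p := 2) (q := 2) IsGaussian.memLp_two_id (Lp.memLp f))

/-- `J f = ∫ ω f(ω) dP(ω)`, a Bochner integral in `𝒲`. -/
def cmJ : Lp ℝ 2 P →ₗ[ℝ] WienerSpace T where
  toFun f := ∫ ω, f ω • ω ∂P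
  map_add' f g := by
    rw [← integral_add (integrable_smul_id P f) (integrable_smul_id P g)]
    refine integral_congr_ae ?_
    filter_upwards [Lp.coeFn_add f g] with ω h
    rw [h, Pi.add_apply, add_smul]
  map_smul' c f := by
    rw [RingHom.id_apply, ← integral_smul]
    refine integral_congr_ae ?_
    filter_upwards [Lp.coeFn_smul c f] with ω h
    rw [h, Pi.smul_apply, smul_smul, smul_eq_mul]

/-- `φ(J f) = ⟨f, φ⟩_{L²(P)}` for `φ ∈ 𝒲*`. -/
theorem dual_cmJ (φ : StrongDual ℝ (WienerSpace T)) (f : Lp ℝ 2 P) :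
    φ (cmJ P f) = inner ℝ (StrongDual.toLp (𝕜 := ℝ) P 2 φ) f := by
  change φ (∫ ω, f ω • ω ∂P) = _
  rw [← φ.integral_comp_comm (integrable_smul_id P f), L2.inner_def]
  refine integral_congr_ae ?_
  rw [StrongDual.toLp_apply IsGaussian.memLp_two_id]
  filter_upwards [(IsGaussian.memLp_two_id.continuousLinearMap_comp φ).coeFn_toLp] with ω h
  rw [map_smul, smul_eq_mul]
  erw [h]
  simp

theorem cmJ_injOn : Function.Injective ((cmJ P).domRestrict (dualClosure P)) := by
  rw [injective_iff_map_eq_zero]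
  rintro ⟨f, hf⟩ h
  have h1 : cmJ P f = 0 := h
  have h2 : f ∈ (dualClosure P)ᗮ := by
    unfold dualClosure
    rw [Submodule.orthogonal_closure, Submodule.mem_orthogonal]
    rintro _ ⟨φ, rfl⟩
    have := dual_cmJ P φ f
    rw [h1, map_zero] at this
    exact this.symm
  have h3 : f = 0 := by
    have := (Submodule.mem_orthogonal _ _).1 h2 f hf
    exact inner_self_eq_zero.1 this
  exact Subtype.ext h3

/-- The Cameron–Martin space `ℋ = J(closure of 𝒲* in L²(P)) ⊆ 𝒲`. -/
def CameronMartin : Type := LinearMap.range ((cmJ P).domRestrict (dualClosure P))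

namespace CameronMartin

instance : AddCommGroup (CameronMartin P) :=
  inferInstanceAs (AddCommGroup (LinearMap.range ((cmJ P).domRestrict (dualClosure P))))

instance : Module ℝ (CameronMartin P) :=
  inferInstanceAs (Module ℝ (LinearMap.range ((cmJ P).domRestrict (dualClosure P))))

/-- `J` as a linear bijection from the closure of `𝒲*` onto `ℋ`. -/
def equivJ : dualClosure P ≃ₗ[ℝ] CameronMartin P :=
  LinearEquiv.ofInjective ((cmJ P).domRestrict (dualClosure P)) (cmJ_injOn P)

variable {P}

/-- The element of `𝒲` underlying an element of `ℋ`. -/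
def path (h : CameronMartin P) : WienerSpace T := Subtype.val h

instance : CoeFun (CameronMartin P) (fun _ => Set.Icc (0 : ℝ) T → ℝ) :=
  ⟨fun h => (h.path.path : C(Set.Icc (0 : ℝ) T, ℝ))⟩

instance : NormedAddCommGroup (CameronMartin P) :=
  NormedAddCommGroup.induced (CameronMartin P) (dualClosure P) (equivJ P).symm
    (equivJ P).symm.injective

/-- The inner product `⟨J f, J g⟩_ℋ = ⟨f, g⟩_{L²(P)}`. -/
instance : InnerProductSpace ℝ (CameronMartin P) where
  norm_smul_le c h := by
    change ‖(equivJ P).symm (c • h)‖ ≤ ‖c‖ * ‖(equivJ P).symm h‖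
    rw [map_smul, norm_smul]
  inner h k := inner ℝ ((equivJ P).symm h) ((equivJ P).symm k)
  norm_sq_eq_re_inner h := norm_sq_eq_re_inner (𝕜 := ℝ) ((equivJ P).symm h)
  conj_inner_symm h k := inner_conj_symm _ _
  add_left h k l := by rw [map_add, inner_add_left]
  smul_left h k c := by
    rw [map_smul]
    exact inner_smul_left ((equivJ P).symm h) ((equivJ P).symm k) c

instance : CompleteSpace (CameronMartin P) := by
  haveI : CompleteSpace (dualClosure P) :=
    (Submodule.isClosed_topologicalClosure _).completeSpace_coe
  let e : CameronMartin P ≃ₗᵢ[ℝ] dualClosure P := ⟨(equivJ P).symm, fun _ => rfl⟩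
  exact (completeSpace_congr e.isometry.isUniformEmbedding (e := e.toEquiv)).2 inferInstance

end CameronMartin

/-- The element `J(ω ↦ ω(t)) = E[B_t B_·]` of `ℋ`. -/
def covElem (t : Set.Icc (0 : ℝ) T) : CameronMartin P :=
  CameronMartin.equivJ P ⟨StrongDual.toLp (𝕜 := ℝ) P 2 (evalDual t),
    Submodule.le_topologicalClosure _ ⟨evalDual t, rfl⟩⟩

/-- `ℋ² = ℋ ⊗ ℝ²`, with `‖h‖² = ‖h¹‖² + ‖h²‖²`. -/
abbrev CameronMartin2 : Type := PiLp 2 (fun _ : Fin 2 => CameronMartin P)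

variable {P}

/-- The `ℝ²`-valued path of `h = (h¹, h²) ∈ ℋ²`. -/
def CameronMartin2.path (h : CameronMartin2 P) :
    Set.Icc (0 : ℝ) T → EuclideanSpace ℝ (Fin 2) :=
  fun t => WithLp.toLp 2 fun i => h i t

/-- `a v := (v¹ a, v² a) ∈ ℋ²` for `a ∈ ℋ` and `v ∈ ℝ²`. -/
def vecMul (v : EuclideanSpace ℝ (Fin 2)) (a : CameronMartin P) : CameronMartin2 P :=
  WithLp.toLp 2 fun i => v i • a

end CameronMartin

/-! ### Fractional Brownian motion, the form `q` -/

/-- The covariance `R(s,t) = (s^{2H} + t^{2H} - |t-s|^{2H}) / 2`. -/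
def fbmCov (T H : ℝ) (s t : Set.Icc (0 : ℝ) T) : ℝ :=
  ((s : ℝ) ^ (2 * H) + (t : ℝ) ^ (2 * H) - |(t : ℝ) - s| ^ (2 * H)) / 2

/-- The Gaussian measure `P` on `𝒲` is the law of fractional Brownian motion with Hurst parameter
`H` on `[0,T]`: the coordinate process is centred with covariance `R`. -/
structure IsFBMLaw {T : ℝ} (H : ℝ) (P : Measure (WienerSpace T)) : Prop where
  gaussian : IsGaussian P
  mean : ∀ t, ∫ ω, evalDual t ω ∂P = 0
  cov : ∀ s t, ∫ ω, evalDual s ω * evalDual t ω ∂P = fbmCov T H s t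

/-- Under the law of fractional Brownian motion, `covElem P t` is the function `R(t,·)`. -/
theorem covElem_apply {T H : ℝ} {P : Measure (WienerSpace T)} [IsGaussian P]
    (hP : IsFBMLaw H P) (t s : Set.Icc (0 : ℝ) T) : covElem P t s = fbmCov T H t s := by
  have h1 : covElem P t s = evalDual s (cmJ P (StrongDual.toLp (𝕜 := ℝ) P 2 (evalDual t))) :=
    rfl
  rw [h1, dual_cmJ, L2.inner_def, ← hP.cov t s]
  refine integral_congr_ae ?_
  rw [StrongDual.toLp_apply IsGaussian.memLp_two_id, StrongDual.toLp_apply IsGaussian.memLp_two_id]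
  filter_upwards [(IsGaussian.memLp_two_id.continuousLinearMap_comp (evalDual s)).coeFn_toLp,
    (IsGaussian.memLp_two_id.continuousLinearMap_comp (evalDual t)).coeFn_toLp] with ω h h'
  erw [h, h']
  simp

/-- Rotation by `-π/2`: `v ↦ ṽ = v² e₁ - v¹ e₂`. -/
def rot (v : EuclideanSpace ℝ (Fin 2)) : EuclideanSpace ℝ (Fin 2) := !₂[v 1, -v 0]

/-- `q(h,k) = (∫₀ᵀ h · dk̃ + ∫₀ᵀ k · dh̃) / 2`. -/
def qForm {T : ℝ} {P : Measure (WienerSpace T)} [IsGaussian P] (h k : CameronMartin2 P) : ℝ :=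
  (youngIntegral (inner ℝ) h.path (fun t => rot (k.path t))
    + youngIntegral (inner ℝ) k.path (fun t => rot (h.path t))) / 2

end FBMArea

end

open FBMArea

/-! The proof rests on the sign structure of the covariance of the increments of fractional Brownian
motion. For H < 1/2, increments over disjoint intervals are nonpositively correlated, while every
increment is nonnegatively correlated with B_T. On the uniform grid with N cells let D be the Gram
matrix of the increments of R(t,·). Polarisation (`sum_inner_mul_eq`) writes the squared norm of ∑
x_k ΔR_k as ∑ |x_i|² (row sum of D) + ½ ∑ |x_j - x_i|² (-D_ij). The row sums are nonnegative with
total T^{2H}, so the first part is at most T^{2H} sup|x|². In the second part the lag-m increments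
of x are controlled by p-variation and Hölder, and the sum over m of the correlation weights times
m^{2/p} is at most N^{2H+2/p-1}. The powers of N cancel exactly, which gives T^{2H}(M² + B^{2/p}),
uniformly in N (`grid_estimate`); the condition on p is p ≤ 1/(1-2H).

Any Riemann–Stieltjes sum is a limit of grid sums of a step function whose variation is no larger
(`tendsto_grid_youngSum`), so the estimate holds for all Young sums. The difference of two Young
sums of fine mesh is of the same kind, with uniformly small integrand; interpolation between p and a
larger exponent makes it small, and the Young integral against R(dt,·) exists
(`youngIntegrable_covElem`). As R(0,·) = 0, Qω is the single integral of ½ω̃(T) - ω̃(t), whose sup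
norm and p-variation are at most ‖ω‖. Hence ‖Qω‖² ≤ 2T^{2H}‖ω‖², and T^{2H} ≤ ‖R‖_r by the one-cell
grid.

On ℋ² the Schur test gives ∑|Δh|² ≤ 2δ^{2H}‖h‖² over disjoint intervals of length at most δ. With δ
= T this is finite 2-variation, and mollification places ℋ² in 𝒲_p² since p > 2. With δ the mesh it
kills the error in the integration by parts, and the reproducing property then identifies ⟨Qh,k⟩
with q(h,k) (`inner_areaFun`). -/

noncomputable section

namespace FBMArea

/-! ### Real inequalities -/

theorem rpow_add_sub_rpow_le {α x y δ : ℝ} (h0 : 0 ≤ α) (h1 : α ≤ 1) (hx : 0 ≤ x) (hxy : x ≤ y)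
    (hδ : 0 ≤ δ) : (y + δ) ^ α - y ^ α ≤ (x + δ) ^ α - x ^ α := by
  rcases hδ.eq_or_lt with rfl | hδ
  · simp
  have hc := (Real.concaveOn_rpow h0 h1).2
  have hd : 0 < y - x + δ := by linarith
  have hyd : y + δ ∈ Set.Ici (0 : ℝ) := by simp only [Set.mem_Ici]; linarith
  have hl : 0 ≤ δ / (y - x + δ) := by positivity
  have hl' : 0 ≤ (y - x) / (y - x + δ) := div_nonneg (by linarith) hd.le
  have hs : δ / (y - x + δ) + (y - x) / (y - x + δ) = 1 := by field_simp; ring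
  -- Both x + δ and y are convex combinations of x and y + δ, with the two weights exchanged; adding
  -- the two concavity inequalities gives the claim.
  have a1 := hc (Set.mem_Ici.2 hx) hyd hl' hl (by linarith)
  have a2 := hc (Set.mem_Ici.2 hx) hyd hl hl' hs
  simp only [smul_eq_mul] at a1 a2
  have e1 : (y - x) / (y - x + δ) * x + δ / (y - x + δ) * (y + δ) = x + δ := by
    field_simp; ring
  have e2 : δ / (y - x + δ) * x + (y - x) / (y - x + δ) * (y + δ) = y := by
    field_simp; ring
  rw [e1] at a1
  rw [e2] at a2
  have e3 : (y - x) / (y - x + δ) = 1 - δ / (y - x + δ) := by linarith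
  rw [e3] at a1 a2
  linarith

/-- With u = n/(n+1) ∈ [0,1): 1 - u^α ≤ 1 - u as α ≤ 1, and 1 - u^γ ≤ 1 - u^{2β} ≤ 2(1 - u^β) as γ ≤
2β. Since α + γ = β + 1 and (n+1)(1-u) = 1, the powers of n + 1 match. This is the induction step of
`sum_fgnWeight_mul_rpow_le`. -/
theorem rpow_diff_mul_rpow_diff_le {α γ β n : ℝ} (hα : 0 < α) (hα1 : α ≤ 1) (hβ : 0 < β)
    (hβe : β = α + γ - 1) (hγβ : γ ≤ 2 * β) (hn : 0 ≤ n) :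
    ((n + 1) ^ α - n ^ α) * ((n + 1) ^ γ - n ^ γ) ≤ 2 * ((n + 1) ^ β - n ^ β) := by
  have hy : 0 < n + 1 := by linarith
  obtain ⟨u, hu0, hu1, hnu⟩ : ∃ u : ℝ, 0 ≤ u ∧ u ≤ 1 ∧ n = u * (n + 1) :=
    ⟨n / (n + 1), by positivity, (div_le_one hy).2 (by linarith), by field_simp⟩
  have hf : ∀ s : ℝ, (n + 1) ^ s - n ^ s = (n + 1) ^ s * (1 - u ^ s) := by
    intro s
    conv_lhs => rw [show n ^ s = (u * (n + 1)) ^ s by rw [← hnu]]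
    rw [Real.mul_rpow hu0 hy.le]; ring
  rw [hf, hf, hf]
  have hγ0 : 0 ≤ γ := by linarith
  have b1 : 1 - u ^ α ≤ 1 - u := by
    have := Real.rpow_le_rpow_of_exponent_ge' hu0 hu1 hα.le hα1
    rw [Real.rpow_one] at this
    linarith
  have b1' : 0 ≤ 1 - u := by linarith
  have b2 : 1 - u ^ γ ≤ 2 * (1 - u ^ β) := by
    have h1 := Real.rpow_le_rpow_of_exponent_ge' hu0 hu1 hγ0 hγβ
    have h2 : u ^ (2 * β) = (u ^ β) ^ 2 := by
      rw [mul_comm, Real.rpow_mul hu0]; norm_cast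
    rw [h2] at h1
    nlinarith [sq_nonneg (1 - u ^ β)]
  have b3 : 0 ≤ 1 - u ^ γ := by linarith [Real.rpow_le_one hu0 hu1 hγ0]
  have e : (n + 1) ^ α * (n + 1) ^ γ = (n + 1) ^ β * (n + 1) := by
    rw [← Real.rpow_add hy, show α + γ = β + 1 by linarith, Real.rpow_add_one hy.ne']
  have e' : (n + 1) * (1 - u) = 1 := by linarith
  calc (n + 1) ^ α * (1 - u ^ α) * ((n + 1) ^ γ * (1 - u ^ γ))
      = ((n + 1) ^ α * (n + 1) ^ γ) * ((1 - u ^ α) * (1 - u ^ γ)) := by ring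
    _ ≤ ((n + 1) ^ α * (n + 1) ^ γ) * ((1 - u) * (2 * (1 - u ^ β))) := by
        gcongr
    _ = (n + 1) ^ β * ((n + 1) * (1 - u)) * (2 * (1 - u ^ β)) := by rw [e]; ring
    _ = 2 * ((n + 1) ^ β * (1 - u ^ β)) := by rw [e']; ring

/-- The absolute correlation `-ρ(k+1)` of the unit increments of fractional Brownian motion at
distance `k + 1`, for `α = 2H`. -/
def fgnWeight (α : ℝ) (k : ℕ) : ℝ :=
  (2 * ((k : ℝ) + 1) ^ α - (k : ℝ) ^ α - ((k : ℝ) + 2) ^ α) / 2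

theorem fgnWeight_nonneg {α : ℝ} (h0 : 0 ≤ α) (h1 : α ≤ 1) (k : ℕ) : 0 ≤ fgnWeight α k := by
  have := rpow_add_sub_rpow_le h0 h1 (Nat.cast_nonneg k) (by linarith : (k : ℝ) ≤ k + 1)
    zero_le_one
  unfold fgnWeight
  rw [show (k : ℝ) + 1 + 1 = k + 2 by ring] at this
  linarith

/-- The weights are halved negative second differences of k^α, so summation by parts moves one
difference onto k^γ. -/
theorem sum_fgnWeight_mul_rpow_le {α γ β : ℝ} (hα : 0 < α) (hα1 : α ≤ 1) (hβ : 0 < β)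
    (hβe : β = α + γ - 1) (hγβ : γ ≤ 2 * β) (N : ℕ) :
    ∑ k ∈ Finset.range N, fgnWeight α k * ((k : ℝ) + 1) ^ γ ≤ (N : ℝ) ^ β := by
  have hγ : 0 < γ := by linarith
  -- The added boundary term of the summation by parts makes the induction close: its step is
  -- exactly half of `rpow_diff_mul_rpow_diff_le`.
  have key : ∑ k ∈ Finset.range N, fgnWeight α k * ((k : ℝ) + 1) ^ γ
      + (((N : ℝ) + 1) ^ α - (N : ℝ) ^ α) * (N : ℝ) ^ γ / 2 ≤ (N : ℝ) ^ β := by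
    induction N with
    | zero => simp [Real.zero_rpow hγ.ne', Real.zero_rpow hβ.ne']
    | succ N ih =>
      rw [Finset.sum_range_succ]
      have h := rpow_diff_mul_rpow_diff_le hα hα1 hβ hβe hγβ (Nat.cast_nonneg N)
      push_cast
      rw [show (N : ℝ) + 1 + 1 = N + 2 by ring]
      unfold fgnWeight at *
      nlinarith
  have : 0 ≤ (((N : ℝ) + 1) ^ α - (N : ℝ) ^ α) * (N : ℝ) ^ γ / 2 := by
    have : (N : ℝ) ^ α ≤ ((N : ℝ) + 1) ^ α := by gcongr; linarith
    have := sub_nonneg.2 this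
    positivity
  linarith

/-! ### Finite sums -/

theorem sum_range_sum_range_symm (S : ℕ → ℕ → ℝ) (hS : ∀ i j, S i j = S j i)
    (h0 : ∀ i, S i i = 0) (N : ℕ) :
    ∑ i ∈ Finset.range N, ∑ j ∈ Finset.range N, S i j
      = 2 * ∑ i ∈ Finset.range N, ∑ k ∈ Finset.range (N - (i + 1)), S i (i + 1 + k) := by
  have h1 : ∀ N, ∑ i ∈ Finset.range N, ∑ k ∈ Finset.range (N - (i + 1)), S i (i + 1 + k)
      = ∑ j ∈ Finset.range N, ∑ i ∈ Finset.range j, S i j := by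
    intro N
    have := Finset.sum_Ico_Ico_comm' 0 N S
    simp only [← Finset.range_eq_Ico] at this
    rw [← this]
    exact Finset.sum_congr rfl fun i _ => (Finset.sum_Ico_eq_sum_range _ _ _).symm
  rw [h1]
  induction N with
  | zero => simp
  | succ N ih =>
    rw [Finset.sum_range_succ, Finset.sum_range_succ (fun j => S N j), h0]
    simp only [Finset.sum_range_succ (fun j => S _ j)]
    rw [Finset.sum_add_distrib, ih, Finset.sum_range_succ (fun j => ∑ i ∈ Finset.range j, S i j),
      Finset.sum_congr rfl fun j (_ : j ∈ Finset.range N) => hS N j]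
    ring

/-- Splitting by residue modulo m turns a sum of lag-m increments into m sums of consecutive
increments along arithmetic progressions. -/
theorem sum_range_mul (f : ℕ → ℝ) (L m : ℕ) :
    ∑ i ∈ Finset.range (L * m), f i
      = ∑ r ∈ Finset.range m, ∑ l ∈ Finset.range L, f (l * m + r) := by
  rw [Finset.sum_comm]
  induction L with
  | zero => simp
  | succ L ih => rw [Nat.succ_mul, Finset.sum_range_add, ih, Finset.sum_range_succ]

/-- Schur test: if the rows of the Gram matrix of the `eᵢ` are bounded by `M` in `ℓ¹`, then
`∑ᵢ ⟨eᵢ,h⟩² ≤ M ‖h‖²`. -/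
theorem sum_inner_sq_le {ι F : Type*} [Fintype ι] [NormedAddCommGroup F] [InnerProductSpace ℝ F]
    (e : ι → F) {M : ℝ} (hM0 : 0 ≤ M) (hM : ∀ i, ∑ j, |(inner ℝ (e i) (e j) : ℝ)| ≤ M) (h : F) :
    ∑ i, (inner ℝ (e i) h : ℝ) ^ 2 ≤ M * ‖h‖ ^ 2 := by
  -- With v = ∑ aᵢ eᵢ one has S = ⟨v,h⟩ ≤ ‖v‖‖h‖, while the row bound gives ‖v‖² ≤ M S. Squaring and
  -- dividing by S yields the claim.
  set a : ι → ℝ := fun i => inner ℝ (e i) h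
  set v : F := ∑ i, a i • e i
  set S : ℝ := ∑ i, a i ^ 2
  have hS0 : 0 ≤ S := Finset.sum_nonneg fun i _ => sq_nonneg _
  have h1 : (inner ℝ v h : ℝ) = S := by
    simp only [v, S, sum_inner, inner_smul_left, RCLike.conj_to_real, sq]
    rfl
  have h2 : ‖v‖ ^ 2 ≤ M * S := by
    rw [← real_inner_self_eq_norm_sq]
    have e1 : (inner ℝ v v : ℝ) = ∑ i, ∑ j, a i * a j * inner ℝ (e i) (e j) := by
      simp only [v, sum_inner, inner_sum, inner_smul_left, inner_smul_right, RCLike.conj_to_real]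
      refine Finset.sum_congr rfl fun i _ => ?_
      rw [Finset.mul_sum]
      refine Finset.sum_congr rfl fun j _ => ?_
      rw [real_inner_comm]; ring
    have e2 : (inner ℝ v v : ℝ) ≤ ∑ i, ∑ j,
        (a i ^ 2 / 2 * |(inner ℝ (e i) (e j) : ℝ)| + a j ^ 2 / 2 * |(inner ℝ (e i) (e j) : ℝ)|) := by
      rw [e1]
      refine Finset.sum_le_sum fun i _ => Finset.sum_le_sum fun j _ => ?_
      have b1 : a i * a j * inner ℝ (e i) (e j) ≤ |a i * a j| * |(inner ℝ (e i) (e j) : ℝ)| := by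
        rw [← abs_mul]; exact le_abs_self _
      have b2 : |a i * a j| ≤ a i ^ 2 / 2 + a j ^ 2 / 2 := by
        rw [abs_mul]
        nlinarith [sq_nonneg (|a i| - |a j|), sq_abs (a i), sq_abs (a j)]
      nlinarith [abs_nonneg (inner ℝ (e i) (e j) : ℝ)]
    refine e2.trans ?_
    simp only [Finset.sum_add_distrib]
    rw [Finset.sum_comm (f := fun i j => a j ^ 2 / 2 * |(inner ℝ (e i) (e j) : ℝ)|)]
    simp only [← Finset.mul_sum]
    have e3 : ∀ j, ∑ i, |(inner ℝ (e i) (e j) : ℝ)| ≤ M := fun j => by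
      simpa only [real_inner_comm] using hM j
    have e4 : ∑ i, a i ^ 2 / 2 * ∑ j, |(inner ℝ (e i) (e j) : ℝ)| ≤ ∑ i, a i ^ 2 / 2 * M :=
      Finset.sum_le_sum fun i _ => mul_le_mul_of_nonneg_left (hM i) (by positivity)
    have e5 : ∑ i, a i ^ 2 / 2 * ∑ j, |(inner ℝ (e j) (e i) : ℝ)| ≤ ∑ i, a i ^ 2 / 2 * M :=
      Finset.sum_le_sum fun i _ => mul_le_mul_of_nonneg_left (e3 i) (by positivity)
    have e6 : ∑ i, a i ^ 2 / 2 * M = M * S / 2 := by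
      rw [← Finset.sum_mul, ← Finset.sum_div]; ring
    linarith
  have h3 : S ≤ ‖v‖ * ‖h‖ := h1 ▸ real_inner_le_norm v h
  rcases hS0.eq_or_lt with h0 | hpos
  · rw [← h0]
    positivity
  · have h4 : S ^ 2 ≤ M * S * ‖h‖ ^ 2 := by
      calc S ^ 2 ≤ (‖v‖ * ‖h‖) ^ 2 := by gcongr
        _ = ‖v‖ ^ 2 * ‖h‖ ^ 2 := by ring
        _ ≤ _ := by gcongr
    nlinarith

/-! ### Sums of powers of increments along monotone sequences -/

/-- `∑ ‖x(u(l+1)) - x(u(l))‖ᵖ ≤ B` along all monotone sequences `u`. -/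
def VarBound {ι E : Type*} [Preorder ι] [NormedAddCommGroup E] (p B : ℝ) (x : ι → E) : Prop :=
  ∀ u : ℕ → ι, Monotone u → ∀ L : ℕ, ∑ l ∈ Finset.range L, ‖x (u (l + 1)) - x (u l)‖ ^ p ≤ B

section VarBound

variable {ι κ E : Type*} [Preorder ι] [Preorder κ] [NormedAddCommGroup E] {p B : ℝ} {x : ι → E}

theorem VarBound.comp (h : VarBound p B x) {m : κ → ι} (hm : Monotone m) :
    VarBound p B (x ∘ m) :=
  fun u hu L => h (m ∘ u) (hm.comp hu) L

theorem VarBound.nonneg [Nonempty ι] (h : VarBound p B x) : 0 ≤ B := by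
  simpa using h (fun _ => Classical.arbitrary ι) monotone_const 0

theorem VarBound.sub_const (h : VarBound p B x) (c : E) : VarBound p B (fun t => x t - c) := by
  intro u hu L
  simpa using h u hu L

theorem VarBound.sub {y : ι → E} {B' : ℝ} (hp : 0 ≤ p) (h : VarBound p B x)
    (h' : VarBound p B' y) : VarBound p (2 ^ p * (B + B')) (fun t => x t - y t) := by
  intro u hu L
  refine le_trans ?_ (mul_le_mul_of_nonneg_left (add_le_add (h u hu L) (h' u hu L))
    (by positivity : (0 : ℝ) ≤ 2 ^ p))
  rw [← Finset.sum_add_distrib, Finset.mul_sum]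
  refine Finset.sum_le_sum fun l _ => ?_
  rw [sub_sub_sub_comm]
  set a := x (u (l + 1)) - x (u l)
  set b := y (u (l + 1)) - y (u l)
  have hab : ‖a - b‖ ≤ 2 * max ‖a‖ ‖b‖ := by
    refine (norm_sub_le a b).trans ?_
    linarith [le_max_left ‖a‖ ‖b‖, le_max_right ‖a‖ ‖b‖]
  have h0 : 0 ≤ max ‖a‖ ‖b‖ := (norm_nonneg a).trans (le_max_left _ _)
  have h1 : (max ‖a‖ ‖b‖) ^ p ≤ ‖a‖ ^ p + ‖b‖ ^ p := by
    have ha : 0 ≤ ‖a‖ ^ p := by positivity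
    have hb : 0 ≤ ‖b‖ ^ p := by positivity
    rcases max_choice ‖a‖ ‖b‖ with hm | hm <;> rw [hm] <;> linarith
  calc ‖a - b‖ ^ p ≤ (2 * max ‖a‖ ‖b‖) ^ p := by gcongr
    _ = 2 ^ p * (max ‖a‖ ‖b‖) ^ p := Real.mul_rpow (by norm_num) h0
    _ ≤ _ := by gcongr

theorem norm_rpow_le_of_le {p' ε : ℝ} (hp : 0 < p) (hpp : p ≤ p') {a : E} (ha : ‖a‖ ≤ ε) :
    ‖a‖ ^ p' ≤ ε ^ (p' - p) * ‖a‖ ^ p := by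
  have h : p' = p' - p + p := by ring
  conv_lhs => rw [h]
  rw [Real.rpow_add_of_nonneg (norm_nonneg a) (by linarith) hp.le]
  gcongr

/-- One factor |Δx|^{p'-p} is bounded by the sup norm. A uniformly small function with bounded
p-variation thus has small p'-variation for p' > p. -/
theorem VarBound.interpolate {p' ε : ℝ} (hp : 0 < p) (hpp : p ≤ p') (h : VarBound p B x)
    (hx : ∀ t, ‖x t‖ ≤ ε) : VarBound p' ((2 * ε) ^ (p' - p) * B) x := by
  intro u hu L
  have hε : 0 ≤ ε := (norm_nonneg _).trans (hx (u 0))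
  refine le_trans ?_ (mul_le_mul_of_nonneg_left (h u hu L) (by positivity))
  rw [Finset.mul_sum]
  refine Finset.sum_le_sum fun l _ => norm_rpow_le_of_le hp hpp ?_
  exact (norm_sub_le _ _).trans (by linarith [hx (u (l + 1)), hx (u l)])

/-- Increments of lag `m`. -/
theorem VarBound.sum_lag_le {x : ℕ → E} (h : VarBound p B x) (N : ℕ) {m : ℕ} (hm : 0 < m) :
    ∑ i ∈ Finset.range N, ‖x (i + m) - x i‖ ^ p ≤ m * B := by
  calc ∑ i ∈ Finset.range N, ‖x (i + m) - x i‖ ^ p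
      -- The range is enlarged to a multiple of m so that it splits into full residue classes.
      ≤ ∑ i ∈ Finset.range (N * m), ‖x (i + m) - x i‖ ^ p := by
        refine Finset.sum_le_sum_of_subset_of_nonneg ?_ fun i _ _ => by positivity
        exact Finset.range_mono (Nat.le_mul_of_pos_right N hm)
    _ = ∑ r ∈ Finset.range m, ∑ l ∈ Finset.range N, ‖x (l * m + r + m) - x (l * m + r)‖ ^ p :=
        sum_range_mul _ N m
    _ ≤ ∑ r ∈ Finset.range m, B := by
        refine Finset.sum_le_sum fun r _ => ?_
        have := h (fun l => l * m + r) (fun a b hab => by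
          change a * m + r ≤ b * m + r; gcongr) N
        refine le_trans (le_of_eq (Finset.sum_congr rfl fun l _ => ?_)) this
        rw [show l * m + r + m = (l + 1) * m + r by ring]
    _ = m * B := by simp

/-- Hölder's inequality for the squares, with exponent p/2 ≥ 1. -/
theorem sum_sq_le_of_sum_rpow_le (hp : 2 ≤ p) {a : ℕ → ℝ} (ha : ∀ i, 0 ≤ a i) {N : ℕ} {C : ℝ}
    (h : ∑ i ∈ Finset.range N, a i ^ p ≤ C) :
    ∑ i ∈ Finset.range N, a i ^ 2 ≤ (N : ℝ) ^ (1 - 2 / p) * C ^ (2 / p) := by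
  have hp0 : 0 < p := by linarith
  have h1 := Real.rpow_sum_le_const_mul_sum_rpow (Finset.range N) (fun i => a i ^ 2)
    (p := p / 2) (by linarith)
  have h2 : ∀ i, |a i ^ 2| = a i ^ 2 := fun i => abs_of_nonneg (sq_nonneg _)
  have h3 : ∀ i, (a i ^ 2) ^ (p / 2) = a i ^ p := fun i => by
    rw [← Real.rpow_natCast, ← Real.rpow_mul (ha i)]
    congr 1; push_cast; ring
  simp only [h2, h3, Finset.card_range] at h1
  have h0 : 0 ≤ ∑ i ∈ Finset.range N, a i ^ 2 := Finset.sum_nonneg fun i _ => sq_nonneg _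
  have hS : 0 ≤ ∑ i ∈ Finset.range N, a i ^ p :=
    Finset.sum_nonneg fun i _ => Real.rpow_nonneg (ha i) _
  calc ∑ i ∈ Finset.range N, a i ^ 2
      = ((∑ i ∈ Finset.range N, a i ^ 2) ^ (p / 2)) ^ (2 / p) := by
        rw [← Real.rpow_mul h0, show p / 2 * (2 / p) = 1 by field_simp, Real.rpow_one]
    _ ≤ ((N : ℝ) ^ (p / 2 - 1) * C) ^ (2 / p) := by
        gcongr
        exact h1.trans (by gcongr)
    _ = (N : ℝ) ^ (1 - 2 / p) * C ^ (2 / p) := by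
        rw [Real.mul_rpow (by positivity) (hS.trans h), ← Real.rpow_mul (by positivity)]
        congr 2
        field_simp

end VarBound

/-! ### Comparison of `VarBound` with the p-variation over partitions. -/

section PVar

variable {T p : ℝ} {E : Type*} [NormedAddCommGroup E]

/-- Partitions are strictly increasing, but the sequences in `VarBound` may stall. A repeated point
is therefore not appended; its increment vanishes, so the sum is the same in both cases. -/
theorem exists_chain_snoc {f : Set.Icc (0 : ℝ) T → E} (hp : 0 < p) {n : ℕ}
    {pt : Fin (n + 1) → Set.Icc (0 : ℝ) T} (hpt : StrictMono pt) (h0 : (pt 0 : ℝ) = 0)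
    {y : Set.Icc (0 : ℝ) T} (hy : pt (Fin.last n) ≤ y) :
    ∃ (n' : ℕ) (pt' : Fin (n' + 1) → Set.Icc (0 : ℝ) T), StrictMono pt' ∧ (pt' 0 : ℝ) = 0 ∧
      pt' (Fin.last n') = y ∧
      ∑ i : Fin n', ‖f (pt' i.succ) - f (pt' i.castSucc)‖ₑ ^ p
        = ∑ i : Fin n, ‖f (pt i.succ) - f (pt i.castSucc)‖ₑ ^ p
          + ‖f y - f (pt (Fin.last n))‖ₑ ^ p := by
  rcases hy.eq_or_lt with rfl | hlt
  · exact ⟨n, pt, hpt, h0, rfl, by simp [hp]⟩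
  · refine ⟨n + 1, Fin.snoc pt y, ?_, ?_, by simp, ?_⟩
    · rw [Fin.strictMono_iff_lt_succ] at hpt ⊢
      intro i
      refine Fin.lastCases ?_ (fun j => ?_) i
      · simpa using hlt
      · rw [Fin.succ_castSucc, Fin.snoc_castSucc, Fin.snoc_castSucc]
        exact hpt j
    · rw [← Fin.castSucc_zero, Fin.snoc_castSucc]; exact h0
    · rw [Fin.sum_univ_castSucc]
      simp only [Fin.succ_castSucc, Fin.snoc_castSucc, Fin.succ_last, Fin.snoc_last]

theorem sum_enorm_rpow_le_pVar {f : Set.Icc (0 : ℝ) T → E} (hp : 0 < p)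
    {u : ℕ → Set.Icc (0 : ℝ) T} (hu : Monotone u) (L : ℕ) :
    ∑ l ∈ Finset.range L, ‖f (u (l + 1)) - f (u l)‖ₑ ^ p ≤ pVar p f ^ p := by
  have hT : 0 ≤ T := (u 0).2.1.trans (u 0).2.2
  have key : ∃ (n : ℕ) (pt : Fin (n + 1) → Set.Icc (0 : ℝ) T), StrictMono pt ∧ (pt 0 : ℝ) = 0 ∧
      pt (Fin.last n) = u L ∧ ∑ l ∈ Finset.range L, ‖f (u (l + 1)) - f (u l)‖ₑ ^ p
        ≤ ∑ i : Fin n, ‖f (pt i.succ) - f (pt i.castSucc)‖ₑ ^ p := by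
    induction L with
    | zero =>
      obtain ⟨n, pt, h1, h2, h3, -⟩ := exists_chain_snoc (f := f) hp (n := 0)
        (pt := fun _ => ⟨0, le_rfl, hT⟩) (Subsingleton.strictMono (α := Fin 1) _) rfl (y := u 0)
        (u 0).2.1
      exact ⟨n, pt, h1, h2, h3, by simp⟩
    | succ L ih =>
      obtain ⟨n, pt, h1, h2, h3, h4⟩ := ih
      obtain ⟨n', pt', h1', h2', h3', h4'⟩ := exists_chain_snoc (f := f) hp h1 h2 (y := u (L + 1))
        (h3 ▸ hu (Nat.le_succ L))
      refine ⟨n', pt', h1', h2', h3', ?_⟩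
      rw [h4', Finset.sum_range_succ, h3]
      gcongr
  obtain ⟨n, pt, h1, h2, -, h4⟩ := key
  -- Appending T completes the chain to a partition of [0,T], at the cost of one nonnegative term.
  obtain ⟨n', pt', h1', h2', h3', h4'⟩ := exists_chain_snoc (f := f) hp h1 h2
    (y := ⟨T, hT, le_rfl⟩) (pt (Fin.last n)).2.2
  let π : TimePartition T := ⟨n', pt', h1', h2', by rw [h3']⟩
  have h5 : ∑ i : Fin n', ‖f (pt' i.succ) - f (pt' i.castSucc)‖ₑ ^ p = pVarSum p f π ^ p := by
    unfold pVarSum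
    rw [← ENNReal.rpow_mul, one_div_mul_cancel hp.ne', ENNReal.rpow_one]
  calc _ ≤ _ := h4
    _ ≤ pVarSum p f π ^ p := by rw [← h5, h4']; exact le_self_add
    _ ≤ _ := by gcongr; exact le_iSup (pVarSum p f) π

theorem enorm_rpow_eq_ofReal (hp : 0 ≤ p) (a : E) : ‖a‖ₑ ^ p = ENNReal.ofReal (‖a‖ ^ p) := by
  rw [← ofReal_norm, ENNReal.ofReal_rpow_of_nonneg (norm_nonneg a) hp]

theorem VarBound.of_pVar {f : Set.Icc (0 : ℝ) T → E} (hp : 0 < p) (h : pVar p f ≠ ⊤) :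
    VarBound p ((pVar p f).toReal ^ p) f := by
  intro u hu L
  have h1 := sum_enorm_rpow_le_pVar (f := f) hp hu L
  simp only [enorm_rpow_eq_ofReal hp.le] at h1
  rw [← ENNReal.ofReal_sum_of_nonneg fun i _ => by positivity] at h1
  have h2 := ENNReal.toReal_mono (ENNReal.rpow_ne_top_of_nonneg hp.le h) h1
  rwa [ENNReal.toReal_ofReal (Finset.sum_nonneg fun i _ => by positivity),
    ← ENNReal.toReal_rpow] at h2

theorem pVar_le_of_sum_le {f : Set.Icc (0 : ℝ) T → E} (hp : 0 < p) {B : ℝ}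
    (h : ∀ π : TimePartition T,
      ∑ i : Fin π.n, ‖f (π.pt i.succ) - f (π.pt i.castSucc)‖ ^ p ≤ B) :
    pVar p f ≤ ENNReal.ofReal B ^ (1 / p) := by
  refine iSup_le fun π => ?_
  unfold pVarSum
  simp only [enorm_rpow_eq_ofReal hp.le]
  rw [← ENNReal.ofReal_sum_of_nonneg fun i _ => by positivity]
  gcongr
  exact h π

end PVar

/-! ### The covariance of fractional Brownian motion -/

theorem sum_fin_sub {G : Type*} [AddCommGroup G] {n : ℕ} (x : Fin (n + 1) → G) :
    ∑ i : Fin n, (x i.succ - x i.castSucc) = x (Fin.last n) - x 0 := by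
  induction n with
  | zero => simp
  | succ n ih =>
    rw [Fin.sum_univ_castSucc]
    have := ih (fun j => x j.castSucc)
    simp only [Fin.succ_castSucc, Fin.castSucc_zero, Fin.succ_last] at this ⊢
    rw [this]
    abel

/-- The function `t ↦ (|t-a|^α - |t-b|^α)/2`, which is the covariance of `B_b - B_a` and `B_t` up
to a constant, has increments dominated by those of a monotone function. -/
theorem exists_monotone_dominating {α a b : ℝ} (h0 : 0 < α) (h1 : α ≤ 1) (hab : a ≤ b) :
    ∃ m : ℝ → ℝ, Monotone m ∧ (∀ s t, m t - m s ≤ 2 * (b - a) ^ α) ∧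
      ∀ c d, c ≤ d →
        |(|d - a| ^ α - |d - b| ^ α) / 2 - (|c - a| ^ α - |c - b| ^ α) / 2| ≤ m d - m c := by
  set g : ℝ → ℝ := fun t => (|t - a| ^ α - |t - b| ^ α) / 2 with hg
  have e1 : ∀ t ≤ a, g t = ((a - t) ^ α - (b - t) ^ α) / 2 := fun t ht => by
    simp only [hg]
    rw [abs_sub_comm t a, abs_sub_comm t b, abs_of_nonneg (by linarith : 0 ≤ a - t),
      abs_of_nonneg (by linarith : 0 ≤ b - t)]
  have e2 : ∀ t, a ≤ t → t ≤ b → g t = ((t - a) ^ α - (b - t) ^ α) / 2 := fun t ht ht' => by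
    simp only [hg]
    rw [abs_sub_comm t b, abs_of_nonneg (by linarith : 0 ≤ t - a),
      abs_of_nonneg (by linarith : 0 ≤ b - t)]
  have e3 : ∀ t, b ≤ t → g t = ((t - a) ^ α - (t - b) ^ α) / 2 := fun t ht => by
    simp only [hg]
    rw [abs_of_nonneg (by linarith : 0 ≤ t - a), abs_of_nonneg (by linarith : 0 ≤ t - b)]
  have m1 : ∀ s t, s ≤ t → t ≤ a → g t ≤ g s := fun s t hst hta => by
    rw [e1 t hta, e1 s (hst.trans hta)]
    have := rpow_add_sub_rpow_le h0.le h1 (by linarith : 0 ≤ a - t) (by linarith : a - t ≤ a - s)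
      (by linarith : 0 ≤ b - a)
    rw [show a - s + (b - a) = b - s by ring, show a - t + (b - a) = b - t by ring] at this
    linarith
  have m2 : ∀ s t, a ≤ s → s ≤ t → t ≤ b → g s ≤ g t := fun s t has hst htb => by
    rw [e2 s has (hst.trans htb), e2 t (has.trans hst) htb]
    have := Real.rpow_le_rpow (by linarith : 0 ≤ s - a) (by linarith : s - a ≤ t - a) h0.le
    have := Real.rpow_le_rpow (by linarith : 0 ≤ b - t) (by linarith : b - t ≤ b - s) h0.le
    linarith
  have m3 : ∀ s t, b ≤ s → s ≤ t → g t ≤ g s := fun s t hbs hst => by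
    rw [e3 s hbs, e3 t (hbs.trans hst)]
    have := rpow_add_sub_rpow_le h0.le h1 (by linarith : 0 ≤ s - b) (by linarith : s - b ≤ t - b)
      (by linarith : 0 ≤ b - a)
    rw [show t - b + (b - a) = t - a by ring, show s - b + (b - a) = s - a by ring] at this
    linarith
  have ga : g a = -((b - a) ^ α / 2) := by
    rw [e1 a le_rfl, sub_self, Real.zero_rpow h0.ne']; ring
  have gb : g b = (b - a) ^ α / 2 := by
    rw [e3 b le_rfl, sub_self, Real.zero_rpow h0.ne']; ring
  have n1 : ∀ t ≤ a, g t ≤ 0 := fun t ht => by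
    rw [e1 t ht]
    have := Real.rpow_le_rpow (by linarith : 0 ≤ a - t) (by linarith : a - t ≤ b - t) h0.le
    linarith
  have n3 : ∀ t, b ≤ t → 0 ≤ g t := fun t ht => by
    rw [e3 t ht]
    have := Real.rpow_le_rpow (by linarith : 0 ≤ t - b) (by linarith : t - b ≤ t - a) h0.le
    linarith
  -- The function g decreases up to a, increases on [a,b] and decreases after b. Clamping t to the
  -- three intervals splits g into monotone pieces, up to constants.
  have dec : ∀ t, g t = g (min t a) + g (max a (min t b)) + g (max t b) - g a - g b := fun t => by
    rcases le_total t a with hta | hta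
    · rw [min_eq_left hta, min_eq_left (hta.trans hab), max_eq_left hta,
        max_eq_right (hta.trans hab)]; ring
    · rcases le_total t b with htb | htb
      · rw [min_eq_right hta, min_eq_left htb, max_eq_right hta, max_eq_right htb]; ring
      · rw [min_eq_right hta, min_eq_right htb, max_eq_right hab, max_eq_left htb]; ring
  have M1 : ∀ c d, c ≤ d → g (min d a) ≤ g (min c a) := fun c d hcd =>
    m1 _ _ (min_le_min_right a hcd) (min_le_right _ _)
  have M2 : ∀ c d, c ≤ d → g (max a (min c b)) ≤ g (max a (min d b)) := fun c d hcd =>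
    m2 _ _ (le_max_left _ _) (max_le_max_left a (min_le_min_right b hcd))
      (max_le hab (min_le_right _ _))
  have M3 : ∀ c d, c ≤ d → g (max d b) ≤ g (max c b) := fun c d hcd =>
    m3 _ _ (le_max_right _ _) (max_le_max_right b hcd)
  -- Reversing the sign of the two decreasing pieces gives the variation function of g. Its range
  -- has length at most ½ + 1 + ½ times (b-a)^α: g has the sign of t outside [a,b] given by `n1` and
  -- `n3`, and g(a), g(b) = ∓(b-a)^α/2.
  refine ⟨fun t => -g (min t a) + g (max a (min t b)) - g (max t b), ?_, ?_, ?_⟩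
  · intro c d hcd
    have := M1 c d hcd; have := M2 c d hcd; have := M3 c d hcd
    simp only
    linarith
  · intro s t
    have a1 := n1 (min s a) (min_le_right _ _)
    have a2 := m1 (min t a) a (min_le_right _ _) le_rfl
    have a3 := n3 (max t b) (le_max_right _ _)
    have a4 := m3 b (max s b) le_rfl (le_max_right _ _)
    have a5 := m2 (max a (min t b)) b (le_max_left _ _) (max_le hab (min_le_right _ _)) le_rfl
    have a6 := m2 a (max a (min s b)) le_rfl (le_max_left _ _) (max_le hab (min_le_right _ _))
    simp only
    linarith
  · intro c d hcd
    change |g d - g c| ≤ _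
    have := M1 c d hcd; have := M2 c d hcd; have := M3 c d hcd
    rw [dec d, dec c, abs_le]
    constructor <;> linarith

/-- The increment of the covariance over the rectangle `[a,b] × [c,d]`. -/
theorem fbmCov_rect {T H : ℝ} (a b c d : Set.Icc (0 : ℝ) T) :
    fbmCov T H b d - fbmCov T H b c - fbmCov T H a d + fbmCov T H a c
      = (|(d : ℝ) - a| ^ (2 * H) - |(d : ℝ) - b| ^ (2 * H)) / 2
        - (|(c : ℝ) - a| ^ (2 * H) - |(c : ℝ) - b| ^ (2 * H)) / 2 := by
  unfold fbmCov; ring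

section Rows

variable {T H : ℝ}

/-- The increments of the dominating monotone function telescope. Subintervals [c_j,d_j] of the
cells are allowed so that tags can be endpoints when integrating by parts. -/
theorem sum_abs_fbmCov_rect_le (h0 : 0 < H) (h1 : H ≤ 1 / 2) {a b : Set.Icc (0 : ℝ) T} (hab : a ≤ b) {n : ℕ}
    {t : Fin (n + 1) → Set.Icc (0 : ℝ) T} {c d : Fin n → Set.Icc (0 : ℝ) T}
    (hc : ∀ i, t i.castSucc ≤ c i) (hcd : ∀ i, c i ≤ d i) (hd : ∀ i, d i ≤ t i.succ) :
    ∑ j, |fbmCov T H b (d j) - fbmCov T H b (c j) - fbmCov T H a (d j) + fbmCov T H a (c j)|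
      ≤ 2 * ((b : ℝ) - a) ^ (2 * H) := by
  obtain ⟨m, hm, hm2, hm3⟩ := exists_monotone_dominating (α := 2 * H) (by linarith) (by linarith)
    (show (a : ℝ) ≤ b from hab)
  calc _ ≤ ∑ j : Fin n, (m (t j.succ) - m (t j.castSucc)) := by
        refine Finset.sum_le_sum fun j _ => ?_
        rw [fbmCov_rect]
        refine (hm3 _ _ (hcd j)).trans ?_
        have := hm (show ((d j : Set.Icc (0 : ℝ) T) : ℝ) ≤ t j.succ from hd j)
        have := hm (show ((t j.castSucc : Set.Icc (0 : ℝ) T) : ℝ) ≤ c j from hc j)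
        linarith
    _ = m (t (Fin.last n)) - m (t 0) := sum_fin_sub (fun j => m (t j))
    _ ≤ _ := hm2 _ _

/-- A row over an interval of length δ has ℓ¹ norm at most S = 2δ^{2H}, so its ρ-th powers sum to at
most S^ρ = 2^ρ δ, because 2Hρ = 1. The lengths δ add up to T. -/
theorem pVar2_fbmCov_ne_top (h0 : 0 < H) (h1 : H ≤ 1 / 2) : pVar2 (1 / (2 * H)) (fbmCov T H) ≠ ⊤ := by
  set ρ : ℝ := 1 / (2 * H) with hρ
  have hρ1 : 1 ≤ ρ := by rw [hρ, le_div_iff₀ (by linarith)]; linarith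
  have hρH : 2 * H * ρ = 1 := by rw [hρ]; field_simp
  have hbound : pVar2 ρ (fbmCov T H) ≤ ENNReal.ofReal (2 ^ ρ * T) ^ (1 / ρ) := by
    refine iSup_le fun π => iSup_le fun σ => ?_
    refine ENNReal.rpow_le_rpow ?_ (by positivity)
    have hmon : ∀ i : Fin π.n, π.pt i.castSucc ≤ π.pt i.succ :=
      fun i => (π.strictMono Fin.castSucc_lt_succ).le
    have hrow : ∀ i : Fin π.n, ∑ j : Fin σ.n,
        |fbmCov T H (π.pt i.succ) (σ.pt j.succ) - fbmCov T H (π.pt i.succ) (σ.pt j.castSucc)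
          - fbmCov T H (π.pt i.castSucc) (σ.pt j.succ)
          + fbmCov T H (π.pt i.castSucc) (σ.pt j.castSucc)| ^ ρ
        ≤ 2 ^ ρ * ((π.pt i.succ : ℝ) - π.pt i.castSucc) := by
      intro i
      have hδ : 0 ≤ (π.pt i.succ : ℝ) - π.pt i.castSucc := sub_nonneg.2 (hmon i)
      have hsum := sum_abs_fbmCov_rect_le h0 h1 (hmon i) (t := σ.pt)
        (c := fun j => σ.pt j.castSucc) (d := fun j => σ.pt j.succ) (fun _ => le_rfl)
        (fun j => (σ.strictMono Fin.castSucc_lt_succ).le) (fun _ => le_rfl)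
      set D : Fin σ.n → ℝ := fun j =>
        |fbmCov T H (π.pt i.succ) (σ.pt j.succ) - fbmCov T H (π.pt i.succ) (σ.pt j.castSucc)
          - fbmCov T H (π.pt i.castSucc) (σ.pt j.succ)
          + fbmCov T H (π.pt i.castSucc) (σ.pt j.castSucc)| with hD
      set S : ℝ := 2 * ((π.pt i.succ : ℝ) - π.pt i.castSucc) ^ (2 * H) with hS
      have hS0 : 0 ≤ S := by positivity
      have hDj : ∀ j, ‖D j‖ ≤ S := fun j => by
        rw [Real.norm_of_nonneg (abs_nonneg _)]
        exact (Finset.single_le_sum (f := D) (fun _ _ => abs_nonneg _)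
          (Finset.mem_univ j)).trans hsum
      calc ∑ j, D j ^ ρ ≤ ∑ j, S ^ (ρ - 1) * D j := by
            refine Finset.sum_le_sum fun j _ => ?_
            have := norm_rpow_le_of_le one_pos hρ1 (hDj j)
            rwa [Real.rpow_one, Real.norm_of_nonneg (abs_nonneg _)] at this
        _ ≤ S ^ (ρ - 1) * S := by rw [← Finset.mul_sum]; gcongr
        _ = S ^ ρ := by
            rw [← Real.rpow_add_one' hS0 (by linarith)]; congr 1; ring
        _ = 2 ^ ρ * ((π.pt i.succ : ℝ) - π.pt i.castSucc) := by
            rw [hS, Real.mul_rpow (by norm_num) (by positivity), ← Real.rpow_mul hδ, hρH,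
              Real.rpow_one]
    simp only [enorm_rpow_eq_ofReal (by linarith : 0 ≤ ρ), Real.norm_eq_abs]
    simp_rw [← ENNReal.ofReal_sum_of_nonneg fun j (_ : j ∈ Finset.univ) =>
      Real.rpow_nonneg (abs_nonneg _) ρ]
    rw [← ENNReal.ofReal_sum_of_nonneg fun i _ => Finset.sum_nonneg fun j _ => by positivity]
    refine ENNReal.ofReal_le_ofReal ((Finset.sum_le_sum fun i _ => hrow i).trans ?_)
    rw [← Finset.mul_sum, π.sum_sub]
  exact ne_top_of_le_ne_top
    (ENNReal.rpow_ne_top_of_nonneg (by positivity) ENNReal.ofReal_ne_top) hbound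

theorem rpow_le_pVar2_fbmCov (h0 : 0 < H) (h1 : H ≤ 1 / 2) (hT : 0 < T) :
    T ^ (2 * H) ≤ (pVar2 (1 / (2 * H)) (fbmCov T H)).toReal := by
  let π : TimePartition T :=
    { n := 1
      pt := ![⟨0, le_rfl, hT.le⟩, ⟨T, hT.le, le_rfl⟩]
      strictMono := by
        rw [Fin.strictMono_iff_lt_succ]
        intro i
        fin_cases i
        exact hT
      pt_zero := rfl
      pt_last := rfl }
  have h2 : 0 < 2 * H := by linarith
  have hle : ENNReal.ofReal (T ^ (2 * H)) ≤ pVar2 (1 / (2 * H)) (fbmCov T H) := by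
    -- On the one-cell grid the only increment is R(T,T) = T^{2H}.
    refine le_trans (le_of_eq ?_) (le_iSup₂_of_le π π le_rfl)
    change _ = (∑ i : Fin 1, ∑ j : Fin 1, _) ^ _
    rw [Fin.sum_univ_one, Fin.sum_univ_one, ← ENNReal.rpow_mul,
      mul_one_div_cancel (one_div_pos.2 h2).ne', ENNReal.rpow_one]
    rw [fbmCov_rect]
    change _ = ‖(|T - 0| ^ (2 * H) - |T - T| ^ (2 * H)) / 2
      - (|0 - 0| ^ (2 * H) - |0 - T| ^ (2 * H)) / 2‖ₑ
    simp only [sub_zero, sub_self, abs_zero, Real.zero_rpow h2.ne', zero_sub, abs_neg,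
      abs_of_pos hT]
    rw [← ofReal_norm, Real.norm_of_nonneg]
    · congr 1; ring
    · have := Real.rpow_nonneg hT.le (2 * H); linarith
  have := ENNReal.toReal_mono (pVar2_fbmCov_ne_top h0 h1) hle
  rwa [ENNReal.toReal_ofReal (by positivity)] at this

end Rows

/-! ### The reproducing kernel -/

section Kernel

variable {T H : ℝ} {P : Measure (WienerSpace T)} [IsGaussian P]

/-- The reproducing property: `dual_cmJ` for the evaluation functional, transported through J. -/
theorem inner_covElem (t : Set.Icc (0 : ℝ) T) (h : CameronMartin P) :
    (inner ℝ (covElem P t) h : ℝ) = h t := by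
  obtain ⟨f, rfl⟩ := (CameronMartin.equivJ P).surjective h
  have h1 : (CameronMartin.equivJ P f) t = WienerSpace.evalDual t (cmJ P f) := rfl
  rw [h1, dual_cmJ]
  change (inner ℝ ((CameronMartin.equivJ P).symm (covElem P t))
    ((CameronMartin.equivJ P).symm (CameronMartin.equivJ P f)) : ℝ) = _
  rw [covElem, LinearEquiv.symm_apply_apply, LinearEquiv.symm_apply_apply]
  rfl

theorem inner_covElem_sub (s t : Set.Icc (0 : ℝ) T) (h : CameronMartin P) :
    (inner ℝ (covElem P t - covElem P s) h : ℝ) = h t - h s := by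
  rw [inner_sub_left, inner_covElem, inner_covElem]

theorem inner_covElem_covElem (hP : IsFBMLaw H P) (s t : Set.Icc (0 : ℝ) T) :
    (inner ℝ (covElem P s) (covElem P t) : ℝ) = fbmCov T H s t := by
  rw [real_inner_comm, inner_covElem, covElem_apply hP s t]

theorem covElem_eq_zero (h0 : 0 < H) (hP : IsFBMLaw H P) {t : Set.Icc (0 : ℝ) T}
    (ht : (t : ℝ) = 0) : covElem P t = 0 := by
  have h := inner_covElem_covElem hP t t
  rw [real_inner_self_eq_norm_sq] at h
  unfold fbmCov at h
  rw [ht, sub_self, abs_zero, Real.zero_rpow (by linarith)] at h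
  simpa using h

theorem inner_covElem_sub_covElem_sub (hP : IsFBMLaw H P) (a b c d : Set.Icc (0 : ℝ) T) :
    (inner ℝ (covElem P b - covElem P a) (covElem P d - covElem P c) : ℝ)
      = fbmCov T H b d - fbmCov T H b c - fbmCov T H a d + fbmCov T H a c := by
  simp only [inner_sub_left, inner_sub_right, inner_covElem_covElem hP]
  ring

theorem norm_covElem_sub_sq (h0 : 0 < H) (hP : IsFBMLaw H P) (s t : Set.Icc (0 : ℝ) T) :
    ‖covElem P t - covElem P s‖ ^ 2 = |(t : ℝ) - s| ^ (2 * H) := by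
  rw [← real_inner_self_eq_norm_sq, inner_covElem_sub_covElem_sub hP, fbmCov_rect, sub_self,
    sub_self, abs_zero, Real.zero_rpow (by linarith), abs_sub_comm (s : ℝ) t]
  ring

theorem continuous_covElem (h0 : 0 < H) (hP : IsFBMLaw H P) : Continuous (covElem P) := by
  rw [continuous_iff_continuousAt]
  intro s
  rw [ContinuousAt, tendsto_iff_norm_sub_tendsto_zero]
  have h1 : Tendsto (fun t : Set.Icc (0 : ℝ) T => |(t : ℝ) - s| ^ (2 * H)) (𝓝 s) (𝓝 0) := by
    have hc : Continuous fun t : Set.Icc (0 : ℝ) T => |(t : ℝ) - s| ^ (2 * H) :=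
      ((continuous_subtype_val.sub continuous_const).abs).rpow_const
        fun _ => Or.inr (by linarith)
    have := hc.tendsto s
    simpa [Real.zero_rpow (by linarith : 2 * H ≠ 0)] using this
  have h2 := h1.sqrt
  simpa [← norm_covElem_sub_sq h0 hP, Real.sqrt_sq] using h2

/-- Increments of `h ∈ ℋ` over disjoint intervals of length at most `δ`. -/
theorem sum_sq_increments_le (h0 : 0 < H) (h1 : H ≤ 1 / 2) (hP : IsFBMLaw H P) {n : ℕ}
    {t : Fin (n + 1) → Set.Icc (0 : ℝ) T} {c d : Fin n → Set.Icc (0 : ℝ) T}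
    (hc : ∀ i, t i.castSucc ≤ c i) (hcd : ∀ i, c i ≤ d i) (hd : ∀ i, d i ≤ t i.succ) {δ : ℝ}
    (hδ0 : 0 ≤ δ) (hδ : ∀ i, (d i : ℝ) - c i ≤ δ) (h : CameronMartin P) :
    ∑ i, (h (d i) - h (c i)) ^ 2 ≤ 2 * δ ^ (2 * H) * ‖h‖ ^ 2 := by
  have := sum_inner_sq_le (fun i => covElem P (d i) - covElem P (c i)) (M := 2 * δ ^ (2 * H))
    (by positivity) (fun i => ?_) h
  · simpa only [inner_covElem_sub] using this
  · simp only [inner_covElem_sub_covElem_sub hP]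
    refine (sum_abs_fbmCov_rect_le h0 h1 (hcd i) hc hcd hd).trans ?_
    have : (c i : ℝ) ≤ d i := hcd i
    gcongr
    exact hδ i

end Kernel

/-! ### Sums over a uniform grid -/

section VecMul

variable {T : ℝ} {P : Measure (WienerSpace T)} [IsGaussian P]

theorem inner_vecMul (v : EuclideanSpace ℝ (Fin 2)) (a : CameronMartin P) (k : CameronMartin2 P) :
    (inner ℝ (vecMul v a) k : ℝ) = ∑ i, v i * inner ℝ a (k i) := by
  simp only [PiLp.inner_apply, vecMul]
  exact Finset.sum_congr rfl fun i _ => by rw [real_inner_smul_left]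

theorem inner_vecMul_vecMul (v w : EuclideanSpace ℝ (Fin 2)) (a b : CameronMartin P) :
    (inner ℝ (vecMul v a) (vecMul w b) : ℝ) = inner ℝ v w * inner ℝ a b := by
  rw [inner_vecMul, PiLp.inner_apply, Finset.sum_mul]
  refine Finset.sum_congr rfl fun i _ => ?_
  simp only [vecMul, real_inner_smul_right]
  simp
  ring

theorem vecMul_add_left (v w : EuclideanSpace ℝ (Fin 2)) (a : CameronMartin P) :
    vecMul (v + w) a = vecMul v a + vecMul w a := by
  refine PiLp.ext fun i => ?_; exact add_smul _ _ _

theorem vecMul_sub_left (v w : EuclideanSpace ℝ (Fin 2)) (a : CameronMartin P) :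
    vecMul (v - w) a = vecMul v a - vecMul w a := by
  refine PiLp.ext fun i => ?_; exact sub_smul _ _ _

theorem vecMul_smul_left (c : ℝ) (v : EuclideanSpace ℝ (Fin 2)) (a : CameronMartin P) :
    vecMul (c • v) a = c • vecMul v a := by
  refine PiLp.ext fun i => ?_; exact mul_smul _ _ _

theorem vecMul_sum_right {ι : Type*} (v : EuclideanSpace ℝ (Fin 2)) (s : Finset ι)
    (a : ι → CameronMartin P) : vecMul v (∑ i ∈ s, a i) = ∑ i ∈ s, vecMul v (a i) := by
  refine PiLp.ext fun j => ?_
  simp [vecMul, Finset.smul_sum]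

theorem continuous_vecMul (v : EuclideanSpace ℝ (Fin 2)) :
    Continuous fun a : CameronMartin P => vecMul v a := by
  unfold vecMul
  fun_prop

end VecMul

/-- Expansion of a quadratic form in terms of its row sums. -/
theorem sum_inner_mul_eq {E : Type*} [NormedAddCommGroup E] [InnerProductSpace ℝ E] (x : ℕ → E)
    (D : ℕ → ℕ → ℝ) (hD : ∀ i j, D i j = D j i) (N : ℕ) :
    ∑ i ∈ Finset.range N, ∑ j ∈ Finset.range N, inner ℝ (x i) (x j) * D i j
      = ∑ i ∈ Finset.range N, ‖x i‖ ^ 2 * ∑ j ∈ Finset.range N, D i j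
        + (∑ i ∈ Finset.range N, ∑ j ∈ Finset.range N, ‖x j - x i‖ ^ 2 * -D i j) / 2 := by
  -- Polarisation: ⟨x,y⟩ = ½|x|² + ½|y|² - ½|y-x|².
  have h1 : ∀ i j, (inner ℝ (x i) (x j) : ℝ) * D i j
      = ‖x i‖ ^ 2 / 2 * D i j + ‖x j‖ ^ 2 / 2 * D j i + (‖x j - x i‖ ^ 2 * -D i j) / 2 := by
    intro i j
    rw [norm_sub_sq_real, real_inner_comm, hD j i]
    ring
  simp only [h1, Finset.sum_add_distrib]
  rw [Finset.sum_comm (f := fun i j => ‖x j‖ ^ 2 / 2 * D j i)]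
  simp only [Finset.mul_sum, Finset.sum_div]
  rw [← Finset.sum_add_distrib]
  congr 1
  refine Finset.sum_congr rfl fun i _ => ?_
  rw [← Finset.sum_add_distrib]
  exact Finset.sum_congr rfl fun j _ => by ring

/-- The points `kT/N` of the uniform grid. -/
def gridPt {T : ℝ} (hT : 0 ≤ T) (N k : ℕ) : Set.Icc (0 : ℝ) T :=
  Set.projIcc 0 T hT (k * (T / N))

theorem gridPt_mono {T : ℝ} (hT : 0 ≤ T) (N : ℕ) : Monotone (gridPt hT N) := fun a b hab =>
  Set.monotone_projIcc hT (by gcongr)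

theorem coe_gridPt {T : ℝ} (hT : 0 ≤ T) {N k : ℕ} (hk : k ≤ N) :
    (gridPt hT N k : ℝ) = k * (T / N) := by
  have : (k : ℝ) * (T / N) ∈ Set.Icc 0 T := by
    refine ⟨by positivity, ?_⟩
    rcases Nat.eq_zero_or_pos N with rfl | hN
    · simpa using hT
    · have : (k : ℝ) ≤ N := by exact_mod_cast hk
      have hN' : (0 : ℝ) < N := by exact_mod_cast hN
      calc (k : ℝ) * (T / N) ≤ N * (T / N) := by gcongr
        _ = T := by field_simp
  rw [gridPt, Set.projIcc_of_mem hT this]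

theorem gridPt_zero {T : ℝ} (hT : 0 ≤ T) (N : ℕ) : (gridPt hT N 0 : ℝ) = 0 := by
  rw [coe_gridPt hT (Nat.zero_le N)]; simp

theorem gridPt_self {T : ℝ} (hT : 0 ≤ T) {N : ℕ} (hN : 0 < N) : (gridPt hT N N : ℝ) = T := by
  rw [coe_gridPt hT le_rfl]
  have hN' : (0 : ℝ) < N := by exact_mod_cast hN
  field_simp

section Grid

variable {T H : ℝ} {P : Measure (WienerSpace T)} [IsGaussian P]

variable (P) in
/-- The increments `R((k+1)T/N,·) - R(kT/N,·)`. -/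
def gridIncr (hT : 0 ≤ T) (N k : ℕ) : CameronMartin P :=
  covElem P (gridPt hT N (k + 1)) - covElem P (gridPt hT N k)

theorem inner_gridIncr_lag (hP : IsFBMLaw H P) (hT : 0 ≤ T) {N i k : ℕ}
    (hk : i + 1 + k < N) :
    (inner ℝ (gridIncr P hT N i) (gridIncr P hT N (i + 1 + k)) : ℝ)
      = -((T / N) ^ (2 * H) * fgnWeight (2 * H) k) := by
  unfold gridIncr
  rw [inner_covElem_sub_covElem_sub hP, fbmCov_rect, coe_gridPt hT (by omega),
    coe_gridPt hT (by omega), coe_gridPt hT (by omega), coe_gridPt hT (by omega)]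
  have hTN : 0 ≤ T / N := by positivity
  have e : ∀ u v w : ℝ, 0 ≤ w → u - v = w * (T / N) →
      |u - v| ^ (2 * H) = w ^ (2 * H) * (T / N) ^ (2 * H) := by
    intro u v w hw huv
    rw [huv, abs_of_nonneg (by positivity), Real.mul_rpow hw hTN]
  have hk0 : (0 : ℝ) ≤ k := Nat.cast_nonneg k
  rw [e _ _ (k + 2) (by positivity) (by push_cast; ring),
    e _ _ (k + 1) (by positivity) (by push_cast; ring),
    e _ _ (k + 1) (by positivity) (by push_cast; ring),
    e _ _ k (by positivity) (by push_cast; ring)]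
  unfold fgnWeight
  ring

theorem sum_gridIncr (h0 : 0 < H) (hP : IsFBMLaw H P) (hT : 0 ≤ T) {N : ℕ} (hN : 0 < N) :
    ∑ k ∈ Finset.range N, gridIncr P hT N k = covElem P ⟨T, hT, le_rfl⟩ := by
  unfold gridIncr
  rw [Finset.sum_range_sub (fun k => covElem P (gridPt hT N k))]
  have e1 : gridPt hT N N = ⟨T, hT, le_rfl⟩ := Subtype.ext (gridPt_self hT hN)
  have e2 : covElem P (gridPt hT N 0) = 0 := covElem_eq_zero h0 hP (gridPt_zero hT N)
  rw [e1, e2, sub_zero]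

/-- The central estimate, uniform in N. The diagonal part of the expansion uses nonnegative row
sums, the rest uses nonpositive correlations at positive lag; both signs come from H < 1/2. -/
theorem grid_estimate (h0 : 0 < H) (h1 : H < 1 / 2) (hP : IsFBMLaw H P) (hT : 0 ≤ T) {p : ℝ}
    (hp : 2 ≤ p) (hp' : p ≤ 1 / (1 - 2 * H)) {N : ℕ} (hN : 0 < N)
    {x : ℕ → EuclideanSpace ℝ (Fin 2)} {M B : ℝ} (hx : ∀ k, ‖x k‖ ≤ M) (hB : VarBound p B x) :
    ‖∑ k ∈ Finset.range N, vecMul (x k) (gridIncr P hT N k)‖ ^ 2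
      ≤ T ^ (2 * H) * (M ^ 2 + B ^ (2 / p)) := by
  set D : ℕ → ℕ → ℝ := fun i j => inner ℝ (gridIncr P hT N i) (gridIncr P hT N j) with hD
  set α : ℝ := 2 * H with hα
  have hB0 : 0 ≤ B := hB.nonneg
  have hN' : (0 : ℝ) < N := by exact_mod_cast hN
  have hTN : 0 ≤ T / N := by positivity
  have expand : ‖∑ k ∈ Finset.range N, vecMul (x k) (gridIncr P hT N k)‖ ^ 2
      = ∑ i ∈ Finset.range N, ∑ j ∈ Finset.range N, inner ℝ (x i) (x j) * D i j := by
    rw [← real_inner_self_eq_norm_sq, sum_inner]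
    refine Finset.sum_congr rfl fun i _ => ?_
    rw [inner_sum]
    exact Finset.sum_congr rfl fun j _ => inner_vecMul_vecMul _ _ _ _
  have hrow : ∀ i, ∑ j ∈ Finset.range N, D i j
      = inner ℝ (gridIncr P hT N i) (covElem P ⟨T, hT, le_rfl⟩) := by
    intro i
    rw [← sum_gridIncr h0 hP hT hN, inner_sum]
  -- The row sum is Cov(B_t - B_s, B_T) = ½(t^α - s^α + (T-s)^α - (T-t)^α), and both differences are
  -- nonnegative.
  have hrow0 : ∀ i ∈ Finset.range N, 0 ≤ ∑ j ∈ Finset.range N, D i j := by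
    intro i hi
    rw [hrow, gridIncr, inner_covElem_sub, covElem_apply hP, covElem_apply hP]
    unfold fbmCov
    have hi' : gridPt hT N i ≤ gridPt hT N (i + 1) := gridPt_mono hT N (Nat.le_succ i)
    set s := gridPt hT N i
    set t := gridPt hT N (i + 1)
    have hst : (s : ℝ) ≤ t := hi'
    have a1 : (s : ℝ) ^ α ≤ (t : ℝ) ^ α := Real.rpow_le_rpow s.2.1 hst (by linarith)
    have a2 : (T - t) ^ α ≤ (T - s) ^ α :=
      Real.rpow_le_rpow (by linarith [t.2.2]) (by linarith) (by linarith)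
    change 0 ≤ (T ^ α + (t : ℝ) ^ α - |(t : ℝ) - T| ^ α) / 2
      - (T ^ α + (s : ℝ) ^ α - |(s : ℝ) - T| ^ α) / 2
    rw [abs_sub_comm (t : ℝ), abs_sub_comm (s : ℝ), abs_of_nonneg (by linarith [t.2.2]),
      abs_of_nonneg (by linarith [s.2.2])]
    linarith
  have htot : ∑ i ∈ Finset.range N, ∑ j ∈ Finset.range N, D i j = T ^ α := by
    simp only [hrow]
    rw [← sum_inner, sum_gridIncr h0 hP hT hN, inner_covElem_covElem hP]
    change (T ^ α + T ^ α - |T - T| ^ α) / 2 = T ^ α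
    rw [sub_self, abs_zero, Real.zero_rpow (by linarith)]
    ring
  have part1 : ∑ i ∈ Finset.range N, ‖x i‖ ^ 2 * ∑ j ∈ Finset.range N, D i j ≤ M ^ 2 * T ^ α := by
    rw [← htot, Finset.mul_sum]
    exact Finset.sum_le_sum fun i hi =>
      mul_le_mul_of_nonneg_right (by gcongr; exact hx i) (hrow0 i hi)
  -- Increments of lag k + 1 have p-th powers summing to at most (k+1)B; Hölder passes to squares.
  have hlag : ∀ k : ℕ, ∑ i ∈ Finset.range N, ‖x (i + 1 + k) - x i‖ ^ 2
      ≤ (N : ℝ) ^ (1 - 2 / p) * (((k : ℝ) + 1) ^ (2 / p) * B ^ (2 / p)) := by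
    intro k
    have hl := hB.sum_lag_le N (Nat.succ_pos k)
    have := sum_sq_le_of_sum_rpow_le hp (a := fun i => ‖x (i + k.succ) - x i‖)
      (fun _ => norm_nonneg _) hl
    rw [Real.mul_rpow (Nat.cast_nonneg _) hB0] at this
    refine le_trans (le_of_eq ?_) (this.trans (le_of_eq ?_))
    · refine Finset.sum_congr rfl fun i _ => ?_
      rw [show i + 1 + k = i + k.succ by omega]
    · push_cast; rfl
  have hw0 := fgnWeight_nonneg (α := α) (by linarith) (by linarith)
  have part2 : (∑ i ∈ Finset.range N, ∑ j ∈ Finset.range N, ‖x j - x i‖ ^ 2 * -D i j) / 2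
      ≤ T ^ α * B ^ (2 / p) := by
    rw [sum_range_sum_range_symm]
    rotate_left
    · intro i j; rw [norm_sub_rev]; simp only [hD]; rw [real_inner_comm]
    · intro i; simp
    have hp0 : 0 < p := by linarith
    -- With γ = 2/p and β = α + γ - 1, this is the condition γ ≤ 2β of the weight estimate; it also
    -- gives β > 0.
    have hq : 1 - α ≤ 1 / p := by
      rw [le_div_iff₀ hp0]
      rw [le_div_iff₀ (by linarith)] at hp'
      linarith
    have hγ : 2 / p = 2 * (1 / p) := by ring
    have hsumw := sum_fgnWeight_mul_rpow_le (α := α) (γ := 2 / p) (β := α + 2 / p - 1)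
      (by linarith) (by linarith) (by linarith) rfl (by linarith) N
    calc 2 * (∑ i ∈ Finset.range N, ∑ k ∈ Finset.range (N - (i + 1)),
            ‖x (i + 1 + k) - x i‖ ^ 2 * -D i (i + 1 + k)) / 2
        = ∑ i ∈ Finset.range N, ∑ k ∈ Finset.range (N - (i + 1)),
            ‖x (i + 1 + k) - x i‖ ^ 2 * ((T / N) ^ α * fgnWeight α k) := by
          rw [mul_div_cancel_left₀ _ (two_ne_zero)]
          refine Finset.sum_congr rfl fun i _ => Finset.sum_congr rfl fun k hk => ?_
          rw [Finset.mem_range] at hk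
          simp only [hD]
          rw [inner_gridIncr_lag hP hT (by omega), neg_neg]
      -- All terms are nonnegative and x is defined on all of ℕ, so lags leaving the grid may be
      -- included; the sums over i and k then separate.
      _ ≤ ∑ i ∈ Finset.range N, ∑ k ∈ Finset.range N,
            ‖x (i + 1 + k) - x i‖ ^ 2 * ((T / N) ^ α * fgnWeight α k) := by
          refine Finset.sum_le_sum fun i _ => Finset.sum_le_sum_of_subset_of_nonneg
            (Finset.range_mono (Nat.sub_le _ _)) fun k _ _ => ?_
          have := hw0 k
          positivity
      _ = ∑ k ∈ Finset.range N, (T / N) ^ α * fgnWeight α k *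
            ∑ i ∈ Finset.range N, ‖x (i + 1 + k) - x i‖ ^ 2 := by
          rw [Finset.sum_comm]
          refine Finset.sum_congr rfl fun k _ => ?_
          rw [Finset.mul_sum]
          exact Finset.sum_congr rfl fun i _ => mul_comm _ _
      _ ≤ ∑ k ∈ Finset.range N, (T / N) ^ α * fgnWeight α k *
            ((N : ℝ) ^ (1 - 2 / p) * (((k : ℝ) + 1) ^ (2 / p) * B ^ (2 / p))) := by
          refine Finset.sum_le_sum fun k _ => mul_le_mul_of_nonneg_left (hlag k) ?_
          have := hw0 k
          positivity
      _ = (T / N) ^ α * (N : ℝ) ^ (1 - 2 / p) * B ^ (2 / p) *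
            ∑ k ∈ Finset.range N, fgnWeight α k * ((k : ℝ) + 1) ^ (2 / p) := by
          rw [Finset.mul_sum]
          exact Finset.sum_congr rfl fun i _ => by ring
      _ ≤ (T / N) ^ α * (N : ℝ) ^ (1 - 2 / p) * B ^ (2 / p) * (N : ℝ) ^ (α + 2 / p - 1) := by
          gcongr
      -- The exponents of N add up to zero: (1 - 2/p) + (α + 2/p - 1) - α.
      _ = T ^ α * B ^ (2 / p) * ((N : ℝ) ^ (1 - 2 / p) * (N : ℝ) ^ (α + 2 / p - 1)
            / (N : ℝ) ^ α) := by
          rw [Real.div_rpow hT hN'.le]; ring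
      _ = T ^ α * B ^ (2 / p) := by
          rw [← Real.rpow_add hN', show 1 - 2 / p + (α + 2 / p - 1) = α by ring,
            div_self (by positivity), mul_one]
  rw [expand, sum_inner_mul_eq x D (fun i j => real_inner_comm _ _)]
  linarith

end Grid

/-! ### The mesh filter -/

section Mesh

variable {T : ℝ}

theorem TimePartition.n_pos (π : TimePartition T) (hT : 0 < T) : 0 < π.n := by
  rcases Nat.eq_zero_or_pos π.n with h | h
  · have : Fin.last π.n = 0 := Fin.ext h
    have h1 := π.pt_last
    rw [this, π.pt_zero] at h1
    exact absurd h1 hT.ne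
  · exact h

theorem TimePartition.sub_le_mesh (π : TimePartition T) (i : Fin π.n) :
    (π.pt i.succ : ℝ) - π.pt i.castSucc ≤ π.mesh :=
  le_ciSup (f := fun i : Fin π.n => ((π.pt i.succ : ℝ) - π.pt i.castSucc))
    (Set.finite_range _).bddAbove i

theorem TimePartition.castSucc_le_succ (π : TimePartition T) (i : Fin π.n) :
    π.pt i.castSucc ≤ π.pt i.succ :=
  (π.strictMono Fin.castSucc_lt_succ).le

theorem TimePartition.mesh_nonneg (π : TimePartition T) : 0 ≤ π.mesh :=
  Real.iSup_nonneg fun i => sub_nonneg.2 (π.castSucc_le_succ i)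

theorem eventually_mesh_lt {δ : ℝ} (hδ : 0 < δ) :
    ∀ᶠ τ in meshFilter T, τ.toTimePartition.mesh < δ :=
  (tendsto_comap (f := fun τ : TaggedPartition T => τ.toTimePartition.mesh)).eventually
    (gt_mem_nhds hδ)

theorem tendsto_mesh : Tendsto (fun τ : TaggedPartition T => τ.toTimePartition.mesh)
    (meshFilter T) (𝓝 0) := tendsto_comap

/-- Needed for uniqueness of limits of Young sums. The witnesses are uniform partitions tagged by
midpoints. -/
theorem meshFilter_neBot (hT : 0 < T) : (meshFilter T).NeBot := by
  have hcoe : ∀ (N : ℕ) (i : Fin (N + 1 + 1)),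
      (gridPt hT.le (N + 1) i : ℝ) = (i : ℕ) * (T / ((N + 1 : ℕ) : ℝ)) := fun N i =>
    coe_gridPt hT.le (Nat.lt_succ_iff.1 i.2)
  have hpos : ∀ N : ℕ, 0 < T / ((N + 1 : ℕ) : ℝ) := fun N => by positivity
  have hmem : ∀ (N : ℕ) (i : Fin (N + 1)),
      (((i : ℕ) : ℝ) + 1 / 2) * (T / ((N + 1 : ℕ) : ℝ)) ∈ Set.Icc 0 T := fun N i => by
    have := (gridPt hT.le (N + 1) i.succ).2.2
    rw [hcoe] at this
    push_cast [Fin.val_succ] at this ⊢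
    have hp := hpos N
    push_cast at hp
    exact ⟨by positivity, by nlinarith⟩
  let τ : ℕ → TaggedPartition T := fun N =>
    { n := N + 1
      pt := fun i => gridPt hT.le (N + 1) i
      strictMono := fun i j hij => by
        change (gridPt hT.le (N + 1) i : ℝ) < gridPt hT.le (N + 1) j
        rw [hcoe, hcoe]
        have : ((i : ℕ) : ℝ) < (j : ℕ) := by exact_mod_cast hij
        exact mul_lt_mul_of_pos_right this (hpos N)
      pt_zero := gridPt_zero hT.le _
      pt_last := gridPt_self hT.le N.succ_pos
      tag := fun i => ⟨(((i : ℕ) : ℝ) + 1 / 2) * (T / ((N + 1 : ℕ) : ℝ)), hmem N i⟩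
      tag_mem := fun i => by
        constructor
        · change (gridPt hT.le (N + 1) i.castSucc : ℝ) < _
          rw [hcoe]
          exact mul_lt_mul_of_pos_right (by simp) (hpos N)
        · change _ < (gridPt hT.le (N + 1) i.succ : ℝ)
          rw [hcoe]
          refine mul_lt_mul_of_pos_right ?_ (hpos N)
          push_cast [Fin.val_succ]
          linarith }
  have hmesh : ∀ N, (τ N).toTimePartition.mesh = T / ((N + 1 : ℕ) : ℝ) := fun N => by
    have : ∀ i : Fin (N + 1), (gridPt hT.le (N + 1) i.succ : ℝ) - gridPt hT.le (N + 1) i.castSucc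
        = T / ((N + 1 : ℕ) : ℝ) := fun i => by
      rw [hcoe, hcoe]; push_cast [Fin.val_succ, Fin.val_castSucc]; ring
    change (⨆ i : Fin (N + 1), ((gridPt hT.le (N + 1) i.succ : ℝ)
      - gridPt hT.le (N + 1) i.castSucc)) = _
    simp only [this, ciSup_const]
  have hτ : Tendsto τ atTop (meshFilter T) := by
    rw [meshFilter, tendsto_comap_iff]
    have : ((fun τ : TaggedPartition T => τ.toTimePartition.mesh) ∘ τ)
        = fun N => T / ((N + 1 : ℕ) : ℝ) := funext hmesh
    rw [this]
    exact (tendsto_const_div_atTop_nhds_zero_nat T).comp (tendsto_add_atTop_nat 1)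
  exact hτ.neBot

/-- The cell of a partition in which a time lies. -/
theorem TimePartition.exists_cell (π : TimePartition T) (hT : 0 < T) :
    ∃ c : Set.Icc (0 : ℝ) T → Fin π.n, Monotone c ∧ ∀ t, π.pt (c t).castSucc ≤ t ∧
      t ≤ π.pt (c t).succ ∧ ((t : ℝ) < T → t < π.pt (c t).succ) := by
  have hn := π.n_pos hT
  have hex : ∀ t, ∃ i : Fin π.n, π.pt i.castSucc ≤ t ∧
      ∀ j : Fin π.n, π.pt j.castSucc ≤ t → j ≤ i := by
    intro t
    let s : Finset (Fin π.n) := Finset.univ.filter fun i => π.pt i.castSucc ≤ t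
    have hs : s.Nonempty := by
      refine ⟨⟨0, hn⟩, ?_⟩
      simp only [s, Finset.mem_filter, Finset.mem_univ, true_and]
      change (π.pt 0 : ℝ) ≤ t
      rw [π.pt_zero]
      exact t.2.1
    refine ⟨s.max' hs, ?_, fun j hj => s.le_max' j (by simpa [s] using hj)⟩
    have := s.max'_mem hs
    simpa only [s, Finset.mem_filter, Finset.mem_univ, true_and] using this
  choose c hc1 hc2 using hex
  have hlt : ∀ t : Set.Icc (0 : ℝ) T, (t : ℝ) < T → t < π.pt (c t).succ := by
    intro t ht
    -- A right endpoint at most t < T would be the left endpoint of a later cell, against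
    -- maximality.
    by_contra! hle
    refine Fin.lastCases (motive := fun i => (c t).succ = i → False) ?_ (fun j hj => ?_)
      (c t).succ rfl
    · intro hl
      rw [hl] at hle
      have : (π.pt (Fin.last _) : ℝ) ≤ t := hle
      rw [π.pt_last] at this
      linarith
    · rw [hj] at hle
      have h1 := hc2 t j hle
      have h2 : ((c t).succ : ℕ) = j := by rw [hj]; rfl
      rw [Fin.val_succ] at h2
      have h3 : (j : ℕ) ≤ c t := h1
      omega
  refine ⟨c, fun s t hst => hc2 t _ ((hc1 s).trans hst), fun t => ⟨hc1 t, ?_, hlt t⟩⟩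
  rcases t.2.2.lt_or_eq with h | h
  · exact (hlt t h).le
  · refine Fin.lastCases (motive := fun i => (c t).succ = i → _) ?_ (fun j hj => ?_)
      (c t).succ rfl
    · intro hl
      change (t : ℝ) ≤ _
      rw [hl, π.pt_last, h]
    · have h1 := hc2 t j (show (π.pt j.castSucc : ℝ) ≤ t by rw [h]; exact (π.pt _).2.2)
      have h2 : ((c t).succ : ℕ) = j := by rw [hj]; rfl
      rw [Fin.val_succ] at h2
      have h3 : (j : ℕ) ≤ c t := h1
      omega

theorem TaggedPartition.tag_monotone (τ : TaggedPartition T) : Monotone τ.tag := by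
  intro i j hij
  rcases hij.eq_or_lt with rfl | hlt
  · exact le_rfl
  · refine (τ.tag_mem i).2.le.trans (le_trans ?_ (τ.tag_mem j).1.le)
    exact τ.strictMono.monotone (by rw [Fin.le_def]; exact hlt)

end Mesh

/-! ### Young sums as limits of sums over uniform grids -/

section Young

variable {T H : ℝ} {P : Measure (WienerSpace T)} [IsGaussian P]

theorem tendsto_gridPt_ceil (hT : 0 < T) (t : Set.Icc (0 : ℝ) T) :
    Tendsto (fun N : ℕ => gridPt hT.le N ⌈(t : ℝ) / T * N⌉₊) atTop (𝓝 t) := by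
  have h1 : Tendsto (fun N : ℕ => (⌈(t : ℝ) / T * N⌉₊ : ℝ) / N) atTop (𝓝 (t / T)) :=
    (tendsto_nat_ceil_mul_div_atTop (R := ℝ) (div_nonneg t.2.1 hT.le)).comp
      tendsto_natCast_atTop_atTop
  have h2 : Tendsto (fun N : ℕ => (⌈(t : ℝ) / T * N⌉₊ : ℝ) * (T / N)) atTop (𝓝 (t : ℝ)) := by
    have := h1.mul_const T
    rw [div_mul_cancel₀ _ hT.ne'] at this
    refine this.congr fun N => ?_
    ring
  have h3 := (continuous_projIcc (h := hT.le)).tendsto (t : ℝ) |>.comp h2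
  rwa [Set.projIcc_val] at h3

/-- Each grid point takes the value of f at the tag of its cell. Within a cell the grid increments
telescope to an increment of R between grid approximations of its endpoints, and t ↦ R(t,·) is
continuous in ℋ. -/
theorem tendsto_grid_youngSum (h0 : 0 < H) (hP : IsFBMLaw H P) (hT : 0 < T)
    (τ : TaggedPartition T) (f : Set.Icc (0 : ℝ) T → EuclideanSpace ℝ (Fin 2))
    {c : Set.Icc (0 : ℝ) T → Fin τ.n}
    (hc : ∀ t, τ.pt (c t).castSucc ≤ t ∧ t ≤ τ.pt (c t).succ ∧
      ((t : ℝ) < T → t < τ.pt (c t).succ)) :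
    Tendsto (fun N => ∑ k ∈ Finset.range N,
        vecMul (f (τ.tag (c (gridPt hT.le N k)))) (gridIncr P hT.le N k))
      atTop (𝓝 (youngSum vecMul f (covElem P) τ)) := by
  have hlim : Tendsto (fun N : ℕ => ∑ i : Fin τ.n, vecMul (f (τ.tag i))
      (covElem P (gridPt hT.le N ⌈(τ.pt i.succ : ℝ) / T * N⌉₊)
        - covElem P (gridPt hT.le N ⌈(τ.pt i.castSucc : ℝ) / T * N⌉₊))) atTop
      (𝓝 (youngSum vecMul f (covElem P) τ)) := by
    refine tendsto_finsetSum _ fun i _ => ?_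
    refine ((continuous_vecMul _).tendsto _).comp (Tendsto.sub ?_ ?_)
    · exact ((continuous_covElem h0 hP).tendsto _).comp (tendsto_gridPt_ceil hT _)
    · exact ((continuous_covElem h0 hP).tendsto _).comp (tendsto_gridPt_ceil hT _)
  refine hlim.congr' ?_
  filter_upwards [eventually_gt_atTop 0] with N hN
  have hN' : (0 : ℝ) < N := by exact_mod_cast hN
  have hTN : 0 < T / N := by positivity
  rw [← Finset.sum_fiberwise (Finset.range N) (fun k => c (gridPt hT.le N k))]
  refine Finset.sum_congr rfl fun i _ => ?_
  have hle : ∀ (t : ℝ) (k : ℕ), ⌈t / T * N⌉₊ ≤ k ↔ t ≤ k * (T / N) := fun t k => by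
    rw [Nat.ceil_le, show t / T * N = t / (T / N) by field_simp, div_le_iff₀ hTN]
  -- Cells are half-open, and k < N keeps the grid point below T, so each fibre is an interval of
  -- indices.
  have hfilter : (Finset.range N).filter (fun k => c (gridPt hT.le N k) = i)
      = Finset.Ico ⌈(τ.pt i.castSucc : ℝ) / T * N⌉₊ ⌈(τ.pt i.succ : ℝ) / T * N⌉₊ := by
    ext k
    rw [Finset.mem_filter, Finset.mem_range, Finset.mem_Ico, ← not_le, ← not_le, hle, hle]
    constructor
    · rintro ⟨hk, rfl⟩
      rw [not_le] at hk
      obtain ⟨a1, -, a3⟩ := hc (gridPt hT.le N k)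
      have a1' : ((τ.pt _ : Set.Icc (0 : ℝ) T) : ℝ) ≤ gridPt hT.le N k := a1
      have hlt : (gridPt hT.le N k : ℝ) < T := by
        rw [coe_gridPt hT.le hk.le]
        have : (k : ℝ) < N := by exact_mod_cast hk
        calc (k : ℝ) * (T / N) < N * (T / N) := by gcongr
          _ = T := by field_simp
      have a3' : (gridPt hT.le N k : ℝ) < (τ.pt _ : Set.Icc (0 : ℝ) T) := a3 hlt
      rw [coe_gridPt hT.le hk.le] at a1' a3'
      exact ⟨a1', not_le.2 a3'⟩
    · rintro ⟨b1, b2⟩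
      rw [not_le] at b2
      have hk : k < N := by
        have h3 : (k : ℝ) * (T / N) < N * (T / N) := by
          rw [mul_div_cancel₀ T hN'.ne']
          exact b2.trans_le (τ.pt i.succ).2.2
        exact_mod_cast lt_of_mul_lt_mul_right h3 hTN.le
      rw [← coe_gridPt hT.le hk.le] at b1 b2
      refine ⟨not_le.2 hk, ?_⟩
      obtain ⟨a1, -, a3⟩ := hc (gridPt hT.le N k)
      have a3 := a3 (b2.trans_le (τ.pt i.succ).2.2)
      have b1' : τ.pt i.castSucc ≤ gridPt hT.le N k := b1
      have b2' : gridPt hT.le N k < τ.pt i.succ := b2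
      have c1 := τ.strictMono.lt_iff_lt.1 (a1.trans_lt b2')
      have c2 := τ.strictMono.lt_iff_lt.1 (b1'.trans_lt a3)
      rw [Fin.lt_def, Fin.val_castSucc, Fin.val_succ] at c1 c2
      exact Fin.ext (by omega)
  have hmono : ⌈(τ.pt i.castSucc : ℝ) / T * N⌉₊ ≤ ⌈(τ.pt i.succ : ℝ) / T * N⌉₊ := by
    refine Nat.ceil_mono ?_
    have : (τ.pt i.castSucc : ℝ) ≤ τ.pt i.succ := τ.castSucc_le_succ i
    gcongr
  rw [Finset.sum_congr rfl fun k hk => by rw [(Finset.mem_filter.1 hk).2], hfilter,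
    ← vecMul_sum_right]
  congr 1
  unfold gridIncr
  exact (Finset.sum_Ico_sub (fun k => covElem P (gridPt hT.le N k)) hmono).symm

/-- The step function is f along the monotone map t ↦ tag of the cell of t, so it inherits both
bounds, and the grid estimate survives the limit. -/
theorem norm_youngSum_sq_le (h0 : 0 < H) (h1 : H < 1 / 2) (hP : IsFBMLaw H P) (hT : 0 < T) {p : ℝ}
    (hp : 2 ≤ p) (hp' : p ≤ 1 / (1 - 2 * H))
    {f : Set.Icc (0 : ℝ) T → EuclideanSpace ℝ (Fin 2)} {M B : ℝ} (hf : ∀ t, ‖f t‖ ≤ M)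
    (hB : VarBound p B f) (τ : TaggedPartition T) :
    ‖youngSum vecMul f (covElem P) τ‖ ^ 2 ≤ T ^ (2 * H) * (M ^ 2 + B ^ (2 / p)) := by
  obtain ⟨c, hcm, hc⟩ := τ.exists_cell hT
  refine le_of_tendsto ((tendsto_grid_youngSum h0 hP hT τ f hc).norm.pow 2) ?_
  filter_upwards [eventually_gt_atTop 0] with N hN
  exact grid_estimate h0 h1 hP hT.le hp hp' hN (fun k => hf _)
    (hB.comp ((τ.tag_monotone.comp hcm).comp (gridPt_mono hT.le N)))

theorem TaggedPartition.abs_tag_cell_sub_le (τ : TaggedPartition T)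
    {c : Set.Icc (0 : ℝ) T → Fin τ.n} {t : Set.Icc (0 : ℝ) T}
    (h1 : τ.pt (c t).castSucc ≤ t) (h2 : t ≤ τ.pt (c t).succ) :
    |(τ.tag (c t) : ℝ) - t| ≤ τ.toTimePartition.mesh := by
  have h1' : (τ.pt (c t).castSucc : ℝ) ≤ t := h1
  have h2' : (t : ℝ) ≤ τ.pt (c t).succ := h2
  have h3 : (τ.pt (c t).castSucc : ℝ) < τ.tag (c t) := (τ.tag_mem (c t)).1
  have h4 : (τ.tag (c t) : ℝ) < τ.pt (c t).succ := (τ.tag_mem (c t)).2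
  have h5 := τ.toTimePartition.sub_le_mesh (c t)
  rw [abs_le]
  constructor <;> linarith

/-- Both sums are limits over the same grids, so their difference comes from the difference of two
step functions. It is at most η because two tags near t are within the sum of the meshes;
interpolation then bounds its p'-variation. -/
theorem norm_youngSum_sub_youngSum_sq_le (h0 : 0 < H) (h1 : H < 1 / 2) (hP : IsFBMLaw H P)
    (hT : 0 < T) {p p' : ℝ} (hp : 2 ≤ p) (hpp : p ≤ p') (hp' : p' ≤ 1 / (1 - 2 * H))
    {f : Set.Icc (0 : ℝ) T → EuclideanSpace ℝ (Fin 2)} {B η : ℝ} (hB : VarBound p B f)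
    (τ σ : TaggedPartition T)
    (hη : ∀ s t : Set.Icc (0 : ℝ) T, |(s : ℝ) - t| ≤ τ.toTimePartition.mesh
      + σ.toTimePartition.mesh → ‖f s - f t‖ ≤ η) :
    ‖youngSum vecMul f (covElem P) τ - youngSum vecMul f (covElem P) σ‖ ^ 2
      ≤ T ^ (2 * H) * (η ^ 2 + ((2 * η) ^ (p' - p) * (2 ^ p * (B + B))) ^ (2 / p')) := by
  obtain ⟨c, hcm, hc⟩ := τ.exists_cell hT
  obtain ⟨d, hdm, hd⟩ := σ.exists_cell hT
  refine le_of_tendsto (((tendsto_grid_youngSum h0 hP hT τ f hc).sub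
    (tendsto_grid_youngSum h0 hP hT σ f hd)).norm.pow 2) ?_
  filter_upwards [eventually_gt_atTop 0] with N hN
  rw [← Finset.sum_sub_distrib]
  simp only [← vecMul_sub_left]
  have hF : ∀ t, ‖f (τ.tag (c t)) - f (σ.tag (d t))‖ ≤ η := fun t => hη _ _ (by
    have a1 := τ.abs_tag_cell_sub_le (hc t).1 (hc t).2.1
    have a2 := σ.abs_tag_cell_sub_le (hd t).1 (hd t).2.1
    rw [abs_le] at *
    constructor <;> linarith)
  have hV : VarBound p (2 ^ p * (B + B)) fun t => f (τ.tag (c t)) - f (σ.tag (d t)) :=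
    VarBound.sub (by linarith) (hB.comp (τ.tag_monotone.comp hcm))
      (hB.comp (σ.tag_monotone.comp hdm))
  exact grid_estimate h0 h1 hP hT.le (hp.trans hpp) hp' hN (fun k => hF _)
    ((hV.interpolate (by linarith) hpp hF).comp (gridPt_mono hT.le N))

/-- Existence of the Young integral against `R(dt,·)`. -/
theorem youngIntegrable_covElem (h0 : 0 < H) (h1 : H < 1 / 2) (hP : IsFBMLaw H P) (hT : 0 < T)
    {p : ℝ} (hp : 2 ≤ p) (hp' : p < 1 / (1 - 2 * H))
    {f : Set.Icc (0 : ℝ) T → EuclideanSpace ℝ (Fin 2)} (hf : Continuous f) {B : ℝ}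
    (hB : VarBound p B f) : YoungIntegrable vecMul f (covElem P) := by
  have := meshFilter_neBot hT
  refine cauchy_map_iff_exists_tendsto.1 (Metric.cauchy_iff.2 ⟨inferInstance, fun ε hε => ?_⟩)
  -- The largest exponent that the grid estimate allows; p < q makes q - p positive, so the bound
  -- vanishes with η.
  set q : ℝ := 1 / (1 - 2 * H) with hq
  have hlim : Tendsto (fun η : ℝ => T ^ (2 * H) *
      (η ^ 2 + ((2 * η) ^ (q - p) * (2 ^ p * (B + B))) ^ (2 / q))) (𝓝 0) (𝓝 0) := by
    have hqp : 0 < q - p := by linarith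
    have h2q : 0 < 2 / q := by have : 0 < q := by linarith
                               positivity
    have hcont : Continuous (fun η : ℝ => T ^ (2 * H) *
        (η ^ 2 + ((2 * η) ^ (q - p) * (2 ^ p * (B + B))) ^ (2 / q))) := by
      refine continuous_const.mul ((continuous_pow 2).add (Continuous.rpow_const
        (Continuous.mul (Continuous.rpow_const (continuous_const.mul continuous_id)
          fun _ => Or.inr hqp.le) continuous_const) fun _ => Or.inr h2q.le))
    have := hcont.tendsto 0
    simpa [Real.zero_rpow hqp.ne', Real.zero_rpow h2q.ne'] using this
  obtain ⟨η, hηε, hη⟩ : ∃ η : ℝ, T ^ (2 * H) *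
      (η ^ 2 + ((2 * η) ^ (q - p) * (2 ^ p * (B + B))) ^ (2 / q)) < ε ^ 2 ∧ 0 < η := by
    have e1 := hlim.eventually (gt_mem_nhds (by positivity : (0 : ℝ) < ε ^ 2))
    exact ((e1.filter_mono nhdsWithin_le_nhds).and
      (self_mem_nhdsWithin : Set.Ioi (0 : ℝ) ∈ 𝓝[>] 0)).exists
  obtain ⟨δ, hδ, hδη⟩ := Metric.uniformContinuous_iff.1
    (CompactSpace.uniformContinuous_of_continuous hf) η hη
  refine ⟨_, image_mem_map (eventually_mesh_lt (T := T) (half_pos hδ)), ?_⟩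
  rintro _ ⟨τ, hτ, rfl⟩ _ ⟨σ, hσ, rfl⟩
  rw [dist_eq_norm]
  refine lt_of_pow_lt_pow_left₀ 2 hε.le (lt_of_le_of_lt ?_ hηε)
  refine norm_youngSum_sub_youngSum_sq_le h0 h1 hP hT hp hp'.le le_rfl hB τ σ fun s t hst => ?_
  rw [← dist_eq_norm]
  refine (hδη ?_).le
  rw [Subtype.dist_eq, Real.dist_eq]
  have a1 : τ.toTimePartition.mesh < δ / 2 := hτ
  have a2 : σ.toTimePartition.mesh < δ / 2 := hσ
  linarith

end Young

/-! ### Paths of finite `2`-variation belong to `𝒲_p` for `p > 2` -/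

section VarBound

variable {ι E : Type*} [Preorder ι] [NormedAddCommGroup E] {p K : ℝ} {x : ι → E}

theorem VarBound.norm_sub_le (hp : 0 < p) (hK : 0 ≤ K) (h : VarBound p (K ^ p) x) {s t : ι}
    (hst : s ≤ t) : ‖x t - x s‖ ≤ K := by
  have := h (fun l => if l = 0 then s else t) (monotone_nat_of_le_succ fun l => by
    rcases Nat.eq_zero_or_pos l with rfl | hl
    · simpa using hst
    · simp [hl.ne']) 1
  simp only [Finset.range_one, Finset.sum_singleton, zero_add, one_ne_zero, if_false,
    if_true] at this
  exact (Real.rpow_le_rpow_iff (norm_nonneg _) hK hp).1 this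

theorem VarBound.mono_exponent {q : ℝ} (hp : 0 < p) (hpq : p ≤ q) (hK : 0 ≤ K)
    (h : VarBound p (K ^ p) x) : VarBound q (K ^ q) x := by
  intro u hu L
  have h1 := mul_le_mul_of_nonneg_left (h u hu L) (Real.rpow_nonneg hK (q - p))
  rw [← Real.rpow_add_of_nonneg hK (by linarith) hp.le, sub_add_cancel, Finset.mul_sum] at h1
  refine le_trans (Finset.sum_le_sum fun l _ => ?_) h1
  exact norm_rpow_le_of_le hp hpq (h.norm_sub_le hp hK (hu (Nat.le_succ l)))

theorem VarBound.pVar_le {T B : ℝ} {f : Set.Icc (0 : ℝ) T → E} (hp : 0 < p)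
    (h : VarBound p B f) : pVar p f ≤ ENNReal.ofReal B ^ (1 / p) := by
  refine pVar_le_of_sum_le hp fun π => ?_
  -- The partition is continued by its last point to an infinite monotone sequence.
  have := h (fun l => π.pt ⟨min l π.n, Nat.lt_succ_of_le (min_le_right _ _)⟩)
    (fun a b hab => π.strictMono.monotone (by
      rw [Fin.mk_le_mk]; exact min_le_min_right _ hab)) π.n
  rw [Finset.sum_range] at this
  refine le_trans (le_of_eq (Finset.sum_congr rfl fun i _ => ?_)) this
  have e1 : i.succ = ⟨min (i + 1) π.n, Nat.lt_succ_of_le (min_le_right _ _)⟩ :=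
    Fin.ext (by simp)
  have e2 : i.castSucc = ⟨min i π.n, Nat.lt_succ_of_le (min_le_right _ _)⟩ :=
    Fin.ext (by simp)
  rw [e1, e2]

end VarBound

/-! ### Mollification preserves 2-variation bounds. -/

section Mollify

variable {E : Type*} [NormedAddCommGroup E] [NormedSpace ℝ E]

/-- Jensen's inequality, as nonnegativity of the variance of K under the density φ. -/
theorem sq_integral_mul_le {φ K : ℝ → ℝ} (hφ : Continuous φ) (hc : HasCompactSupport φ)
    (h0 : ∀ t, 0 ≤ φ t) (h1 : ∫ t, φ t = 1) (hK : Continuous K) :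
    (∫ t, φ t * K t) ^ 2 ≤ ∫ t, φ t * K t ^ 2 := by
  have hint : ∀ {G : ℝ → ℝ}, Continuous G → Integrable fun t => φ t * G t := fun hG =>
    (hφ.mul hG).integrable_of_hasCompactSupport hc.mul_right
  set m := ∫ t, φ t * K t
  have h2 : 0 ≤ ∫ t, φ t * (K t - m) ^ 2 :=
    integral_nonneg fun t => mul_nonneg (h0 t) (sq_nonneg _)
  have h3 : (fun t => φ t * (K t - m) ^ 2)
      = fun t => (φ t * K t ^ 2 - 2 * m * (φ t * K t)) + m ^ 2 * φ t := by
    ext t; ring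
  have i1 : Integrable fun t => φ t * K t ^ 2 := hint (hK.pow 2)
  have i2 := hint hK
  have i3 : Integrable φ := hφ.integrable_of_hasCompactSupport hc
  have i12 : Integrable fun t => φ t * K t ^ 2 - 2 * m * (φ t * K t) := i1.sub (i2.const_mul _)
  rw [h3, integral_add i12 (i3.const_mul _),
    integral_sub i1 (i2.const_mul _), integral_const_mul, integral_const_mul, h1] at h2
  change 0 ≤ _ - 2 * m * m + m ^ 2 * 1 at h2
  linarith

/-- Convolution averages translates of F. By Jensen each squared increment is at most the average of
those of the translates, and a translated monotone sequence is monotone, so B is unchanged. -/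
theorem VarBound.convolution {φ : ℝ → ℝ} (hφ : Continuous φ) (hc : HasCompactSupport φ)
    (h0 : ∀ t, 0 ≤ φ t) (h1 : ∫ t, φ t = 1) {F : ℝ → E} (hF : Continuous F) {B : ℝ}
    (hB : VarBound 2 B F) :
    VarBound 2 B (MeasureTheory.convolution φ F (ContinuousLinearMap.lsmul ℝ ℝ) volume) := by
  intro u hu L
  have hint : ∀ {G : ℝ → ℝ}, Continuous G → Integrable fun t => φ t * G t := fun hG =>
    (hφ.mul hG).integrable_of_hasCompactSupport hc.mul_right
  have hsh : ∀ y : ℝ, Continuous fun t => F (y - t) := fun y =>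
    hF.comp (continuous_const.sub continuous_id)
  have hintE : ∀ y : ℝ, Integrable fun t => φ t • F (y - t) := fun y =>
    (hφ.smul (hsh y)).integrable_of_hasCompactSupport hc.smul_right
  have hterm : ∀ y z : ℝ, ‖MeasureTheory.convolution φ F (ContinuousLinearMap.lsmul ℝ ℝ) volume y
      - MeasureTheory.convolution φ F (ContinuousLinearMap.lsmul ℝ ℝ) volume z‖ ^ (2 : ℝ)
      ≤ ∫ t, φ t * ‖F (y - t) - F (z - t)‖ ^ (2 : ℝ) := by
    intro y z
    have e : MeasureTheory.convolution φ F (ContinuousLinearMap.lsmul ℝ ℝ) volume y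
        - MeasureTheory.convolution φ F (ContinuousLinearMap.lsmul ℝ ℝ) volume z
        = ∫ t, φ t • (F (y - t) - F (z - t)) := by
      simp only [smul_sub]
      exact (integral_sub (hintE y) (hintE z)).symm
    have hn : ‖∫ t, φ t • (F (y - t) - F (z - t))‖ ≤ ∫ t, φ t * ‖F (y - t) - F (z - t)‖ := by
      refine (norm_integral_le_integral_norm _).trans (le_of_eq ?_)
      congr 1; ext t
      rw [norm_smul, Real.norm_of_nonneg (h0 t)]
    rw [e]
    simp only [Real.rpow_two]
    calc _ ≤ (∫ t, φ t * ‖F (y - t) - F (z - t)‖) ^ 2 := by gcongr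
      _ ≤ _ := sq_integral_mul_le hφ hc h0 h1 ((hsh y).sub (hsh z)).norm
  have hcont : ∀ l, Continuous fun t => ‖F (u (l + 1) - t) - F (u l - t)‖ ^ (2 : ℝ) := fun l =>
    ((hsh _).sub (hsh _)).norm.rpow_const fun _ => Or.inr (by norm_num)
  calc _ ≤ ∑ l ∈ Finset.range L, ∫ t, φ t * ‖F (u (l + 1) - t) - F (u l - t)‖ ^ (2 : ℝ) :=
        Finset.sum_le_sum fun l _ => hterm _ _
    _ = ∫ t, φ t * ∑ l ∈ Finset.range L, ‖F (u (l + 1) - t) - F (u l - t)‖ ^ (2 : ℝ) := by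
        rw [← integral_finsetSum _ fun l _ => hint (hcont l)]
        simp only [Finset.mul_sum]
    _ ≤ ∫ t, φ t * B := by
        refine integral_mono (hint (continuous_finsetSum _ fun l _ => hcont l))
          (hint continuous_const) fun t => mul_le_mul_of_nonneg_left ?_ (h0 t)
        exact hB (fun l => u l - t) (fun a b hab => sub_le_sub_right (hu hab) t) L
    _ = B := by rw [integral_mul_const, h1, one_mul]

/-- Mollified paths converge uniformly with bounded 2-variation, hence in p-variation for p > 2 by
interpolation. -/
theorem mem_wienerPSubmodule_of_varBound_two [CompleteSpace E] {T p : ℝ} [Fact (1 ≤ p)]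
    (hT : 0 < T) (hp : 2 < p) {f : C(Set.Icc (0 : ℝ) T, E)} (hf0 : f ∈ startZero T E) {B : ℝ}
    (hB : VarBound 2 B f) : f ∈ wienerPSubmodule T p E := by
  refine ⟨hf0, fun ε hε => ?_⟩
  have hp0 : 0 < p := by linarith
  have hlim : Tendsto (fun η : ℝ => ENNReal.ofReal ((2 * (2 * η)) ^ (p - 2) * (2 ^ (2 : ℝ) * (B + B)))
      ^ (1 / p)) (𝓝 0) (𝓝 0) := by
    have hcont : Continuous fun η : ℝ =>
        ENNReal.ofReal ((2 * (2 * η)) ^ (p - 2) * (2 ^ (2 : ℝ) * (B + B))) ^ (1 / p) := by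
      refine ENNReal.continuous_rpow_const.comp (ENNReal.continuous_ofReal.comp ?_)
      exact ((continuous_const.mul (continuous_const.mul continuous_id)).rpow_const
        fun _ => Or.inr (by linarith)).mul continuous_const
    have := hcont.tendsto 0
    rwa [mul_zero, mul_zero, Real.zero_rpow (by linarith), zero_mul, ENNReal.ofReal_zero,
      ENNReal.zero_rpow_of_pos (by positivity)] at this
  obtain ⟨η, hηε, hη⟩ : ∃ η : ℝ, ENNReal.ofReal ((2 * (2 * η)) ^ (p - 2)
      * (2 ^ (2 : ℝ) * (B + B))) ^ (1 / p) < ε ∧ 0 < η :=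
    (((hlim.eventually (gt_mem_nhds hε)).filter_mono nhdsWithin_le_nhds).and
      (self_mem_nhdsWithin : Set.Ioi (0 : ℝ) ∈ 𝓝[>] 0)).exists
  obtain ⟨δ, hδ, hδη⟩ := Metric.uniformContinuous_iff.1
    (CompactSpace.uniformContinuous_of_continuous f.continuous) η hη
  -- Extension by constants outside [0,T] preserves continuity and the 2-variation bound.
  set F : ℝ → E := fun y => f (Set.projIcc 0 T hT.le y) with hFdef
  have hF : Continuous F := f.continuous.comp continuous_projIcc
  have hFB : VarBound 2 B F := hB.comp (Set.monotone_projIcc hT.le)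
  let b : ContDiffBump (0 : ℝ) := ⟨δ / 2, δ, half_pos hδ, half_lt_self hδ⟩
  set φ : ℝ → ℝ := b.normed volume
  set G : ℝ → E := MeasureTheory.convolution φ F (ContinuousLinearMap.lsmul ℝ ℝ) volume with hG
  have hφc : HasCompactSupport φ := b.hasCompactSupport_normed
  have hGB : VarBound 2 B G := VarBound.convolution b.continuous_normed hφc
    (fun t => b.nonneg_normed t) b.integral_normed hF hFB
  have hGs : ContDiff ℝ (⊤ : ℕ∞) G :=
    HasCompactSupport.contDiff_convolution_left _ hφc b.contDiff_normed hF.locallyIntegrable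
  have hGF : ∀ y, ‖F y - G y‖ ≤ η := by
    intro y
    rw [← dist_eq_norm, dist_comm]
    refine b.dist_normed_convolution_le hF.aestronglyMeasurable fun z hz => (hδη ?_).le
    rw [Subtype.dist_eq]
    have h1 : dist z y < δ := hz
    have h2 := (LipschitzWith.projIcc hT.le).dist_le_mul z y
    rw [NNReal.coe_one, one_mul] at h2
    exact lt_of_le_of_lt h2 h1
  have hF0 : F 0 = 0 := by
    refine hf0 _ ?_
    rw [Set.projIcc_of_mem hT.le (Set.left_mem_Icc.2 hT.le)]
  have hFt : ∀ t : Set.Icc (0 : ℝ) T, F t = f t := fun t => by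
    simp only [hFdef, Set.projIcc_val]
  -- Subtracting G(0) restores the starting value 0; it doubles the uniform error to 2η.
  let g : C(Set.Icc (0 : ℝ) T, E) :=
    ⟨fun t => G t - G 0, (hGs.continuous.comp continuous_subtype_val).sub continuous_const⟩
  refine ⟨g, ⟨fun t ht => ?_, fun y => G y - G 0, (hGs.sub contDiff_const).contDiffOn,
    fun _ => rfl⟩, ?_⟩
  · change G t - G 0 = 0
    rw [ht, sub_self]
  · have hfg : ((f - g : C(Set.Icc (0 : ℝ) T, E)) : Set.Icc (0 : ℝ) T → E)
        = fun t => f t - g t := rfl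
    have hgB : VarBound 2 B g :=
      (hGB.comp (m := fun t : Set.Icc (0 : ℝ) T => (t : ℝ)) (fun _ _ h => h)).sub_const (G 0)
    have hd : ∀ t, ‖f t - g t‖ ≤ 2 * η := fun t => by
      have e : f t - g t = (F t - G t) - (F 0 - G 0) := by
        rw [hF0, hFt]
        change f t - (G t - G 0) = _
        abel
      rw [e]
      exact (norm_sub_le _ _).trans (by linarith [hGF t, hGF 0])
    rw [hfg]
    exact (VarBound.pVar_le hp0 ((hB.sub (by norm_num) hgB).interpolate two_pos hp.le hd)).trans_lt
      hηε

end Mollify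

/-! ### The embedding of `ℋ²` into `𝒲_p²` -/

section Embedding

variable {T H : ℝ} {P : Measure (WienerSpace T)} [IsGaussian P]

theorem CameronMartin2.norm_path_sub_sq (h : CameronMartin2 P) (s t : Set.Icc (0 : ℝ) T) :
    ‖h.path t - h.path s‖ ^ 2 = ∑ i, (h i t - h i s) ^ 2 := by
  rw [EuclideanSpace.norm_sq_eq]
  exact Finset.sum_congr rfl fun i _ => by rw [Real.norm_eq_abs, sq_abs]; rfl

theorem sum_norm_sq_increments_le (h0 : 0 < H) (h1 : H ≤ 1 / 2) (hP : IsFBMLaw H P) {n : ℕ}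
    {t : Fin (n + 1) → Set.Icc (0 : ℝ) T} {c d : Fin n → Set.Icc (0 : ℝ) T}
    (hc : ∀ i, t i.castSucc ≤ c i) (hcd : ∀ i, c i ≤ d i) (hd : ∀ i, d i ≤ t i.succ) {δ : ℝ}
    (hδ0 : 0 ≤ δ) (hδ : ∀ i, (d i : ℝ) - c i ≤ δ) (h : CameronMartin2 P) :
    ∑ i, ‖h.path (d i) - h.path (c i)‖ ^ 2 ≤ 2 * δ ^ (2 * H) * ‖h‖ ^ 2 := by
  simp only [CameronMartin2.norm_path_sub_sq]
  rw [Finset.sum_comm, PiLp.norm_sq_eq_of_L2, Finset.mul_sum]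
  exact Finset.sum_le_sum fun j _ => sum_sq_increments_le h0 h1 hP hc hcd hd hδ0 hδ (h j)

theorem CameronMartin2.varBound_two (h0 : 0 < H) (h1 : H ≤ 1 / 2) (hP : IsFBMLaw H P)
    (hT : 0 ≤ T) (h : CameronMartin2 P) :
    VarBound 2 ((√(2 * T ^ (2 * H)) * ‖h‖) ^ (2 : ℝ)) h.path := by
  intro u hu L
  have := sum_norm_sq_increments_le h0 h1 hP (n := L) (t := fun i => u i) (c := fun i => u i)
    (d := fun i => u (i + 1)) (fun i => le_rfl) (fun i => hu (Nat.le_succ i)) (fun i => by simp)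
    hT (fun i => by linarith [(u (i + 1)).2.2, (u i).2.1]) h
  simp only [Real.rpow_two]
  rw [Finset.sum_range, mul_pow, Real.sq_sqrt (by positivity)]
  exact this

theorem CameronMartin2.continuous_path (h : CameronMartin2 P) : Continuous h.path := by
  unfold CameronMartin2.path
  have : ∀ i, Continuous fun t => h i t := fun i => ((h i).path.path).continuous
  fun_prop

theorem CameronMartin2.path_zero (h : CameronMartin2 P) {t : Set.Icc (0 : ℝ) T}
    (ht : (t : ℝ) = 0) : h.path t = 0 := by
  ext i
  exact (Subtype.prop (h i).path : (h i).path.path ∈ startZero T ℝ) t ht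

/-- The inclusion `ℋ² ⊆ 𝒲_p²`. -/
def toWienerP {p : ℝ} [Fact (1 ≤ p)] (h0 : 0 < H) (h1 : H ≤ 1 / 2) (hP : IsFBMLaw H P)
    (hT : 0 < T) (hp : 2 < p) : CameronMartin2 P →L[ℝ] WienerP T p (EuclideanSpace ℝ (Fin 2)) :=
  LinearMap.mkContinuous
    { toFun := fun h => ⟨⟨h.path, h.continuous_path⟩, mem_wienerPSubmodule_of_varBound_two hT hp
        (fun _ ht => h.path_zero ht) (h.varBound_two h0 h1 hP hT.le)⟩
      map_add' := fun _ _ => rfl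
      map_smul' := fun _ _ => rfl } (√(2 * T ^ (2 * H))) (fun h => by
    have hp0 : 0 < p := by linarith
    have hK : 0 ≤ √(2 * T ^ (2 * H)) * ‖h‖ := by positivity
    have h2 := VarBound.pVar_le hp0
      ((h.varBound_two h0 h1 hP hT.le).mono_exponent two_pos hp.le hK)
    rw [← ENNReal.ofReal_rpow_of_nonneg hK hp0.le, ← ENNReal.rpow_mul,
      mul_one_div_cancel hp0.ne', ENNReal.rpow_one] at h2
    exact ENNReal.toReal_le_of_le_ofReal hK h2)

end Embedding

/-! ### The rotation -/

theorem rot_sub (v w : EuclideanSpace ℝ (Fin 2)) : rot (v - w) = rot v - rot w := by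
  ext i; fin_cases i <;> simp [rot]; ring

theorem rot_add (v w : EuclideanSpace ℝ (Fin 2)) : rot (v + w) = rot v + rot w := by
  ext i; fin_cases i <;> simp [rot]; ring

theorem rot_smul (c : ℝ) (v : EuclideanSpace ℝ (Fin 2)) : rot (c • v) = c • rot v := by
  ext i; fin_cases i <;> simp [rot]

theorem norm_rot (v : EuclideanSpace ℝ (Fin 2)) : ‖rot v‖ = ‖v‖ := by
  rw [EuclideanSpace.norm_eq, EuclideanSpace.norm_eq, Fin.sum_univ_two, Fin.sum_univ_two]
  simp [rot, add_comm]

theorem inner_rot (v w : EuclideanSpace ℝ (Fin 2)) :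
    (inner ℝ v (rot w) : ℝ) = -inner ℝ (rot v) w := by
  simp [PiLp.inner_apply, rot, Fin.sum_univ_two]

theorem continuous_rot : Continuous rot := by
  unfold rot; fun_prop

theorem VarBound.rot {ι : Type*} [Preorder ι] {p B : ℝ} {x : ι → EuclideanSpace ℝ (Fin 2)}
    (h : VarBound p B x) : VarBound p B fun t => FBMArea.rot (x t) := by
  intro u hu L
  simpa only [← rot_sub, norm_rot] using h u hu L

/-! ### Young sums against `R(dt,·)` -/

section Young

variable {T H : ℝ} {P : Measure (WienerSpace T)} [IsGaussian P]

theorem YoungIntegrable.hasYoungIntegral {A B C : Type*} [AddCommGroup B] [AddCommGroup C]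
    [TopologicalSpace C] {m : A → B → C} {f : Set.Icc (0 : ℝ) T → A} {g : Set.Icc (0 : ℝ) T → B}
    (h : YoungIntegrable m f g) : HasYoungIntegral m f g (youngIntegral m f g) :=
  have : Nonempty C := ⟨0⟩
  tendsto_nhds_limUnder h

theorem youngSum_const (hT : 0 ≤ T) (hP : IsFBMLaw H P) (h0 : 0 < H)
    (v : EuclideanSpace ℝ (Fin 2)) (τ : TaggedPartition T) :
    youngSum vecMul (fun _ => v) (covElem P) τ = vecMul v (covElem P ⟨T, hT, le_rfl⟩) := by
  unfold youngSum
  rw [← vecMul_sum_right, sum_fin_sub (fun i => covElem P (τ.pt i))]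
  have e1 : τ.pt (Fin.last _) = ⟨T, hT, le_rfl⟩ := Subtype.ext τ.pt_last
  have e2 : covElem P (τ.pt 0) = 0 := covElem_eq_zero h0 hP τ.pt_zero
  rw [e1, e2, sub_zero]

theorem youngSum_add (f g : Set.Icc (0 : ℝ) T → EuclideanSpace ℝ (Fin 2))
    (R : Set.Icc (0 : ℝ) T → CameronMartin P) (τ : TaggedPartition T) :
    youngSum vecMul (fun t => f t + g t) R τ = youngSum vecMul f R τ + youngSum vecMul g R τ := by
  unfold youngSum
  simp only [vecMul_add_left, Finset.sum_add_distrib]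

theorem youngSum_sub (f g : Set.Icc (0 : ℝ) T → EuclideanSpace ℝ (Fin 2))
    (R : Set.Icc (0 : ℝ) T → CameronMartin P) (τ : TaggedPartition T) :
    youngSum vecMul (fun t => f t - g t) R τ = youngSum vecMul f R τ - youngSum vecMul g R τ := by
  unfold youngSum
  simp only [vecMul_sub_left, Finset.sum_sub_distrib]

theorem youngSum_smul (a : ℝ) (f : Set.Icc (0 : ℝ) T → EuclideanSpace ℝ (Fin 2))
    (R : Set.Icc (0 : ℝ) T → CameronMartin P) (τ : TaggedPartition T) :
    youngSum vecMul (fun t => a • f t) R τ = a • youngSum vecMul f R τ := by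
  unfold youngSum
  simp only [vecMul_smul_left, Finset.smul_sum]

/-- Pairing with `k ∈ ℋ²` turns sums against `R(dt,·)` into sums against `dk`. -/
theorem inner_youngSum_covElem (f : Set.Icc (0 : ℝ) T → EuclideanSpace ℝ (Fin 2))
    (k : CameronMartin2 P) (τ : TaggedPartition T) :
    (inner ℝ (youngSum vecMul f (covElem P) τ) k : ℝ) = youngSum (inner ℝ) f k.path τ := by
  unfold youngSum
  rw [sum_inner]
  refine Finset.sum_congr rfl fun i _ => ?_
  rw [inner_vecMul, PiLp.inner_apply]
  refine Finset.sum_congr rfl fun j _ => ?_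
  rw [inner_covElem_sub]
  simp [CameronMartin2.path, mul_comm]

/-- The rotation is antisymmetric, so the tilde moves from integrator to integrand with a change of
sign. -/
theorem youngSum_inner_rot (f g : Set.Icc (0 : ℝ) T → EuclideanSpace ℝ (Fin 2))
    (τ : TaggedPartition T) :
    youngSum (inner ℝ) f (fun t => rot (g t)) τ = -youngSum (inner ℝ) (fun t => rot (f t)) g τ := by
  unfold youngSum
  rw [← Finset.sum_neg_distrib]
  exact Finset.sum_congr rfl fun i _ => by rw [← rot_sub, inner_rot]

/-- Integration by parts: the error of the Riemann–Stieltjes sums. -/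
theorem abs_youngSum_by_parts_le {E : Type*} [NormedAddCommGroup E] [InnerProductSpace ℝ E]
    (a k : Set.Icc (0 : ℝ) T → E) (τ : TaggedPartition T) :
    |(inner ℝ (a (τ.pt (Fin.last _))) (k (τ.pt (Fin.last _))) : ℝ)
        - inner ℝ (a (τ.pt 0)) (k (τ.pt 0))
        - youngSum (inner ℝ) a k τ - youngSum (inner ℝ) k a τ|
      ≤ (∑ i : Fin τ.n, ‖a (τ.pt i.succ) - a (τ.tag i)‖ ^ 2
          + ∑ i : Fin τ.n, ‖k (τ.pt i.succ) - k (τ.tag i)‖ ^ 2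
          + ∑ i : Fin τ.n, ‖a (τ.tag i) - a (τ.pt i.castSucc)‖ ^ 2
          + ∑ i : Fin τ.n, ‖k (τ.tag i) - k (τ.pt i.castSucc)‖ ^ 2) / 2 := by
  unfold youngSum
  rw [← sum_fin_sub (fun i => (inner ℝ (a (τ.pt i)) (k (τ.pt i)) : ℝ)), ← Finset.sum_sub_distrib,
    ← Finset.sum_sub_distrib, ← Finset.sum_add_distrib, ← Finset.sum_add_distrib,
    ← Finset.sum_add_distrib, Finset.sum_div]
  refine (Finset.abs_sum_le_sum_abs _ _).trans (Finset.sum_le_sum fun i _ => ?_)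
  -- On each cell the error is a difference of products of increments over the two halves cut off by
  -- the tag.
  have e : (inner ℝ (a (τ.pt i.succ)) (k (τ.pt i.succ)) : ℝ)
      - inner ℝ (a (τ.pt i.castSucc)) (k (τ.pt i.castSucc))
      - inner ℝ (a (τ.tag i)) (k (τ.pt i.succ) - k (τ.pt i.castSucc))
      - inner ℝ (k (τ.tag i)) (a (τ.pt i.succ) - a (τ.pt i.castSucc))
      = inner ℝ (a (τ.pt i.succ) - a (τ.tag i)) (k (τ.pt i.succ) - k (τ.tag i))
        - inner ℝ (a (τ.tag i) - a (τ.pt i.castSucc)) (k (τ.tag i) - k (τ.pt i.castSucc)) := by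
    simp only [inner_sub_left, inner_sub_right]
    rw [real_inner_comm (a (τ.pt i.succ)) (k (τ.tag i)),
      real_inner_comm (a (τ.pt i.castSucc)) (k (τ.tag i))]
    ring
  rw [e]
  have b : ∀ v w : E, |(inner ℝ v w : ℝ)| ≤ (‖v‖ ^ 2 + ‖w‖ ^ 2) / 2 := fun v w =>
    (abs_real_inner_le_norm v w).trans (by nlinarith [sq_nonneg (‖v‖ - ‖w‖)])
  refine (abs_sub _ _).trans ?_
  have b1 := b (a (τ.pt i.succ) - a (τ.tag i)) (k (τ.pt i.succ) - k (τ.tag i))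
  have b2 := b (a (τ.tag i) - a (τ.pt i.castSucc)) (k (τ.tag i) - k (τ.pt i.castSucc))
  linarith

/-- The error is a sum of products of increments of h̃ and k; by the Schur bound with δ the mesh it
is O(mesh^{2H}). The boundary term at 0 vanishes. -/
theorem tendsto_youngSum_by_parts (h0 : 0 < H) (h1 : H ≤ 1 / 2) (hP : IsFBMLaw H P) (hT : 0 ≤ T)
    (h k : CameronMartin2 P) :
    Tendsto (fun τ => youngSum (inner ℝ) (fun t => rot (h.path t)) k.path τ
        + youngSum (inner ℝ) k.path (fun t => rot (h.path t)) τ) (meshFilter T)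
      (𝓝 (inner ℝ (rot (h.path ⟨T, hT, le_rfl⟩)) (k.path ⟨T, hT, le_rfl⟩))) := by
  have hlim : Tendsto (fun τ : TaggedPartition T =>
      2 * τ.toTimePartition.mesh ^ (2 * H) * (‖h‖ ^ 2 + ‖k‖ ^ 2)) (meshFilter T) (𝓝 0) := by
    have h2 : Tendsto (fun δ : ℝ => 2 * δ ^ (2 * H) * (‖h‖ ^ 2 + ‖k‖ ^ 2)) (𝓝 0) (𝓝 0) := by
      have hc : Continuous fun δ : ℝ => 2 * δ ^ (2 * H) * (‖h‖ ^ 2 + ‖k‖ ^ 2) :=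
        (continuous_const.mul (continuous_id.rpow_const fun _ => Or.inr (by linarith))).mul
          continuous_const
      have := hc.tendsto 0
      rwa [Real.zero_rpow (by linarith), mul_zero, zero_mul] at this
    exact h2.comp tendsto_mesh
  rw [tendsto_iff_norm_sub_tendsto_zero]
  refine squeeze_zero (fun _ => norm_nonneg _) (fun τ => ?_) hlim
  have key := abs_youngSum_by_parts_le (fun t => rot (h.path t)) k.path τ
  have hlast : τ.pt (Fin.last _) = ⟨T, hT, le_rfl⟩ := Subtype.ext τ.pt_last
  simp only [← rot_sub, norm_rot] at key
  rw [hlast, k.path_zero τ.pt_zero, inner_zero_right, sub_zero] at key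
  rw [Real.norm_eq_abs, abs_sub_comm, ← sub_sub]
  refine key.trans ?_
  have htag : ∀ i, τ.pt i.castSucc ≤ τ.tag i ∧ τ.tag i ≤ τ.pt i.succ := fun i =>
    ⟨(τ.tag_mem i).1.le, (τ.tag_mem i).2.le⟩
  have hR : ∀ g : CameronMartin2 P, ∑ i : Fin τ.n, ‖g.path (τ.pt i.succ) - g.path (τ.tag i)‖ ^ 2
      ≤ 2 * τ.toTimePartition.mesh ^ (2 * H) * ‖g‖ ^ 2 := fun g =>
    sum_norm_sq_increments_le h0 h1 hP (t := τ.pt) (fun i => (htag i).1) (fun i => (htag i).2)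
      (fun i => le_rfl) τ.mesh_nonneg (fun i => by
        have := τ.sub_le_mesh i
        have : (τ.pt i.castSucc : ℝ) ≤ τ.tag i := (htag i).1
        linarith) g
  have hL : ∀ g : CameronMartin2 P,
      ∑ i : Fin τ.n, ‖g.path (τ.tag i) - g.path (τ.pt i.castSucc)‖ ^ 2
      ≤ 2 * τ.toTimePartition.mesh ^ (2 * H) * ‖g‖ ^ 2 := fun g =>
    sum_norm_sq_increments_le h0 h1 hP (t := τ.pt) (fun i => le_rfl) (fun i => (htag i).1)
      (fun i => (htag i).2) τ.mesh_nonneg (fun i => by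
        have := τ.sub_le_mesh i
        have : (τ.tag i : ℝ) ≤ τ.pt i.succ := (htag i).2
        linarith) g
  linarith [hR h, hR k, hL h, hL k]

end Young

/-! ### The operator `Q` -/

section Operator

variable {T H p : ℝ} {P : Measure (WienerSpace T)} [IsGaussian P] [Fact (1 ≤ p)]

theorem WienerP.varBound (hp : 0 < p) (ω : WienerP T p (EuclideanSpace ℝ (Fin 2))) :
    VarBound p (‖ω‖ ^ p) ω.path :=
  VarBound.of_pVar hp ω.pVar_ne_top

theorem WienerP.youngIntegrable (h0 : 0 < H) (h1 : H < 1 / 2) (hP : IsFBMLaw H P) (hT : 0 < T)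
    (hp : 2 ≤ p) (hp' : p < 1 / (1 - 2 * H)) (ω : WienerP T p (EuclideanSpace ℝ (Fin 2))) :
    YoungIntegrable vecMul (fun t => rot (ω.path t)) (covElem P) :=
  youngIntegrable_covElem h0 h1 hP hT hp hp' (continuous_rot.comp ω.path.continuous)
    (ω.varBound (by linarith)).rot

variable (P) in
/-- `½ R(T,·) ω̃(T) - ∫₀ᵀ ω̃(t) R(dt,·)`. -/
def areaFun (hT : 0 ≤ T) (ω : WienerP T p (EuclideanSpace ℝ (Fin 2))) : CameronMartin2 P :=
  (1 / 2 : ℝ) • vecMul (rot (ω.path ⟨T, hT, le_rfl⟩)) (covElem P ⟨T, hT, le_rfl⟩)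
    - youngIntegral vecMul (fun t => rot (ω.path t)) (covElem P)

/-- A constant v integrates to v R(T,·) because R(0,·) = 0, so the boundary term is absorbed into
the integrand. Linearity and the norm bound are then read off from Young sums. -/
theorem tendsto_areaFun (h0 : 0 < H) (h1 : H < 1 / 2) (hP : IsFBMLaw H P) (hT : 0 < T)
    (hp : 2 ≤ p) (hp' : p < 1 / (1 - 2 * H)) (ω : WienerP T p (EuclideanSpace ℝ (Fin 2))) :
    Tendsto (youngSum vecMul
        (fun t => (1 / 2 : ℝ) • rot (ω.path ⟨T, hT.le, le_rfl⟩) - rot (ω.path t)) (covElem P))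
      (meshFilter T) (𝓝 (areaFun P hT.le ω)) := by
  have hI := (WienerP.youngIntegrable h0 h1 hP hT hp hp' ω).hasYoungIntegral
  refine ((tendsto_const_nhds (x := (1 / 2 : ℝ) • vecMul (rot (ω.path ⟨T, hT.le, le_rfl⟩))
    (covElem P ⟨T, hT.le, le_rfl⟩))).sub hI).congr fun τ => ?_
  rw [youngSum_sub, youngSum_const hT.le hP h0, vecMul_smul_left]

theorem norm_areaFun_sq_le (h0 : 0 < H) (h1 : H < 1 / 2) (hP : IsFBMLaw H P) (hT : 0 < T)
    (hp : 2 ≤ p) (hp' : p < 1 / (1 - 2 * H)) (ω : WienerP T p (EuclideanSpace ℝ (Fin 2))) :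
    ‖areaFun P hT.le ω‖ ^ 2 ≤ 2 * T ^ (2 * H) * ‖ω‖ ^ 2 := by
  have := meshFilter_neBot hT
  have hp0 : 0 < p := by linarith
  refine le_of_tendsto ((tendsto_areaFun h0 h1 hP hT hp hp' ω).norm.pow 2)
    (Eventually.of_forall fun τ => ?_)
  have hV := ω.varBound hp0
  have hω0 : ω.path ⟨0, le_rfl, hT.le⟩ = 0 :=
    (Subtype.prop ω : ω.path ∈ wienerPSubmodule T p _).1 _ rfl
  set e : Set.Icc (0 : ℝ) T := ⟨T, hT.le, le_rfl⟩
  -- The integrand is ½(ω(T) - ω(t)) - ½ω(t) up to rotation; each increment is at most ‖ω‖, since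
  -- ω(0) = 0.
  have hM : ∀ t, ‖(1 / 2 : ℝ) • rot (ω.path e) - rot (ω.path t)‖ ≤ ‖ω‖ := by
    intro t
    rw [← rot_smul, ← rot_sub, norm_rot]
    have b1 : ‖ω.path t - ω.path ⟨0, le_rfl, hT.le⟩‖ ≤ ‖ω‖ :=
      hV.norm_sub_le hp0 (norm_nonneg ω) (show (0 : ℝ) ≤ t from t.2.1)
    have b2 : ‖ω.path e - ω.path t‖ ≤ ‖ω‖ :=
      hV.norm_sub_le hp0 (norm_nonneg ω) (show (t : ℝ) ≤ T from t.2.2)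
    rw [hω0, sub_zero] at b1
    have e1 : (1 / 2 : ℝ) • ω.path e - ω.path t
        = (1 / 2 : ℝ) • (ω.path e - ω.path t) - (1 / 2 : ℝ) • ω.path t := by
      rw [smul_sub, sub_sub, ← add_smul]; norm_num
    rw [e1]
    refine (norm_sub_le _ _).trans ?_
    rw [norm_smul, norm_smul, Real.norm_of_nonneg (by norm_num)]
    linarith
  have hB : VarBound p (‖ω‖ ^ p) fun t => (1 / 2 : ℝ) • rot (ω.path e) - rot (ω.path t) := by
    intro u hu L
    have := hV.rot u hu L
    simp only [sub_sub_sub_cancel_left]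
    simpa only [norm_sub_rev] using this
  -- With M = ‖ω‖ and B = ‖ω‖^p, the factor M² + B^{2/p} is 2‖ω‖².
  have := norm_youngSum_sq_le h0 h1 hP hT hp hp'.le hM hB τ
  rw [← Real.rpow_mul (norm_nonneg _), mul_div_cancel₀ _ hp0.ne', Real.rpow_two] at this
  linarith

/-- The operator `Q : 𝒲_p² → ℋ²`. -/
def areaOp (h0 : 0 < H) (h1 : H < 1 / 2) (hP : IsFBMLaw H P) (hT : 0 < T)
    (hp : 2 ≤ p) (hp' : p < 1 / (1 - 2 * H)) :
    WienerP T p (EuclideanSpace ℝ (Fin 2)) →L[ℝ] CameronMartin2 P :=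
  LinearMap.mkContinuous
    { toFun := areaFun P hT.le
      map_add' := fun ω η => by
        have := meshFilter_neBot hT
        refine tendsto_nhds_unique (tendsto_areaFun h0 h1 hP hT hp hp' (ω + η))
          (((tendsto_areaFun h0 h1 hP hT hp hp' ω).add
            (tendsto_areaFun h0 h1 hP hT hp hp' η)).congr fun τ => ?_)
        rw [← youngSum_add]
        congr 1
        ext1 t
        have e : ∀ s, (ω + η).path s = ω.path s + η.path s := fun _ => rfl
        rw [e, e, rot_add, rot_add, smul_add]
        abel
      map_smul' := fun a ω => by
        have := meshFilter_neBot hT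
        refine tendsto_nhds_unique (tendsto_areaFun h0 h1 hP hT hp hp' (a • ω))
          (((tendsto_areaFun h0 h1 hP hT hp hp' ω).const_smul a).congr fun τ => ?_)
        rw [← youngSum_smul]
        congr 1
        ext1 t
        have e : ∀ s, (a • ω).path s = a • ω.path s := fun _ => rfl
        rw [e, e, rot_smul, rot_smul, smul_sub, smul_comm] }
    (√(2 * T ^ (2 * H))) fun ω => by
      refine (pow_le_pow_iff_left₀ (norm_nonneg _) (by positivity) two_ne_zero).1 ?_
      rw [mul_pow, Real.sq_sqrt (by positivity)]
      exact norm_areaFun_sq_le h0 h1 hP hT hp hp' ω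

/-- On `ℋ²` the operator `Q` represents the form `q`. -/
theorem inner_areaFun (h0 : 0 < H) (h1 : H < 1 / 2) (hP : IsFBMLaw H P) (hT : 0 < T)
    (hp : 2 < p) (hp' : p < 1 / (1 - 2 * H)) (h k : CameronMartin2 P) :
    YoungIntegrable (inner ℝ) h.path (fun t => rot (k.path t)) ∧
      inner ℝ (areaFun P hT.le (toWienerP h0 h1.le hP hT hp h)) k = qForm h k := by
  have := meshFilter_neBot hT
  have hI : ∀ h : CameronMartin2 P, HasYoungIntegral vecMul (fun t => rot (h.path t)) (covElem P)
      (youngIntegral vecMul (fun t => rot (h.path t)) (covElem P)) := fun h =>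
    (WienerP.youngIntegrable h0 h1 hP hT hp.le hp'
      (toWienerP h0 h1.le hP hT hp h)).hasYoungIntegral
  set I : CameronMartin2 P → CameronMartin2 P := fun h =>
    youngIntegral vecMul (fun t => rot (h.path t)) (covElem P) with hIdef
  -- Pairing with k is continuous, so the limit in ℋ² yields ∫ h̃·dk; no separate existence argument
  -- is needed for the real integrals.
  have hS : ∀ h k : CameronMartin2 P, HasYoungIntegral (inner ℝ) (fun t => rot (h.path t)) k.path
      (inner ℝ (I h) k) := fun h k =>
    ((hI h).inner tendsto_const_nhds).congr fun τ => inner_youngSum_covElem _ k τ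
  have hY : ∀ h k : CameronMartin2 P, HasYoungIntegral (inner ℝ) h.path (fun t => rot (k.path t))
      (-inner ℝ (I h) k) := fun h k =>
    (hS h k).neg.congr fun τ => (youngSum_inner_rot _ _ τ).symm
  have hval : ∀ h k : CameronMartin2 P,
      youngIntegral (inner ℝ) h.path (fun t => rot (k.path t)) = -inner ℝ (I h) k := fun h k =>
    tendsto_nhds_unique (YoungIntegrable.hasYoungIntegral ⟨_, hY h k⟩) (hY h k)
  refine ⟨⟨_, hY h k⟩, ?_⟩
  -- Integration by parts: h̃(T)·k(T) = ⟨I h,k⟩ - ⟨I k,h⟩. This turns ½h̃(T)·k(T) - ⟨I h,k⟩ into the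
  -- symmetric expression of q.
  have hparts := tendsto_nhds_unique (tendsto_youngSum_by_parts h0 h1.le hP hT.le h k)
    ((hS h k).add (hY k h))
  rw [qForm, hval, hval]
  change (inner ℝ ((1 / 2 : ℝ) • vecMul (rot (h.path ⟨T, hT.le, le_rfl⟩))
    (covElem P ⟨T, hT.le, le_rfl⟩) - I h) k : ℝ) = _
  have e : (inner ℝ (vecMul (rot (h.path ⟨T, hT.le, le_rfl⟩)) (covElem P ⟨T, hT.le, le_rfl⟩)) k : ℝ)
      = inner ℝ (rot (h.path ⟨T, hT.le, le_rfl⟩)) (k.path ⟨T, hT.le, le_rfl⟩) := by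
    rw [inner_vecMul, PiLp.inner_apply]
    refine Finset.sum_congr rfl fun i _ => ?_
    rw [inner_covElem]
    simp [CameronMartin2.path, mul_comm]
  rw [inner_sub_left, real_inner_smul_left, e, hparts]
  ring

end Operator

end FBMArea

end

open FBMArea
theorem proposition3p4 {T H p : ℝ} (hT : 0 < T) (hH : 1 / 3 < H) (hH' : H < 1 / 2)
    [Fact (1 ≤ p)] (hp : 1 / H < p) (hp' : p < 1 / (1 - 2 * H))
    (P : Measure (WienerSpace T)) [IsGaussian P] (hP : IsFBMLaw H P) :
    -- `Q₀` is the operator on `ℋ²` with `⟨Q₀ h, k⟩ = q(h, k)`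
    ∃ Q₀ : CameronMartin2 P →L[ℝ] CameronMartin2 P,
      (∀ h k : CameronMartin2 P,
        YoungIntegrable (inner ℝ) h.path (fun t => rot (k.path t)) ∧
        inner ℝ (Q₀ h) k = qForm h k) ∧
      pVar2 (1 / (2 * H)) (fbmCov T H) ≠ ⊤ ∧
      ∃ Q : WienerP T p (EuclideanSpace ℝ (Fin 2)) →L[ℝ] CameronMartin2 P,
        -- `ℋ² ⊆ 𝒲_p²` and `Q` extends `Q₀`
        (∀ h : CameronMartin2 P, ∃ ω : WienerP T p (EuclideanSpace ℝ (Fin 2)),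
          (∀ t, ω.path t = h.path t) ∧ Q ω = Q₀ h) ∧
        -- `Q ω = ½ R(T,·) ω̃(T) - ∫₀ᵀ ω̃(t) R(dt,·)`, the integral being a limit in `ℋ²`
        (∀ ω : WienerP T p (EuclideanSpace ℝ (Fin 2)),
          YoungIntegrable vecMul (fun t => rot (ω.path t)) (covElem P) ∧
          Q ω = (1 / 2 : ℝ) • vecMul (rot (ω.path ⟨T, hT.le, le_rfl⟩)) (covElem P ⟨T, hT.le, le_rfl⟩)
            - youngIntegral vecMul (fun t => rot (ω.path t)) (covElem P)) ∧
        ∀ ω : WienerP T p (EuclideanSpace ℝ (Fin 2)),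
          ‖Q ω‖ ^ 2 ≤
            (T ^ (2 * H) / 4 + 2 * (pVar2 (1 / (2 * H)) (fbmCov T H)).toReal) * ‖ω‖ ^ 2 := by
  have h0 : 0 < H := by linarith
  -- H < 1/2 gives p > 1/H > 2, as the embedding of ℋ² requires.
  have hp2 : 2 < p := by
    refine lt_trans ?_ hp
    rw [lt_div_iff₀ h0]
    linarith
  refine ⟨(areaOp h0 hH' hP hT hp2.le hp').comp (toWienerP h0 hH'.le hP hT hp2),
    fun h k => inner_areaFun h0 hH' hP hT hp2 hp' h k, pVar2_fbmCov_ne_top h0 hH'.le,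
    areaOp h0 hH' hP hT hp2.le hp', fun h => ⟨toWienerP h0 hH'.le hP hT hp2 h, fun _ => rfl, rfl⟩,
    fun ω => ⟨ω.youngIntegrable h0 hH' hP hT hp2.le hp', rfl⟩, fun ω => ?_⟩
  refine (norm_areaFun_sq_le h0 hH' hP hT hp2.le hp' ω).trans ?_
  -- The bound 2T^{2H} is already at most 2‖R‖_r; the term T^{2H}/4 is slack.
  have h1 := rpow_le_pVar2_fbmCov h0 hH'.le hT
  have h2 : 0 ≤ T ^ (2 * H) := by positivity
  gcongr
  linarith
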